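/- **Setting.** Let $k$ be an algebraically closed field of characteristic $0$. A *fusion category* over $k$ is a $k$-linear abelian rigid monoidal category $\mathcal C$ (tensor product bilinear on morphisms) with simple unit object $\mathbf 1$ and finite-dimensional morphism spaces, having finitely many isomorphism classes of simple objects, such that every object is a finite direct sum of simple objects. Let $\mathcal C$ be a *modular fusion category*: a braided fusion category with a spherical pivotal structure such that the canonical functor $\mathcal C^{\mathrm{rev}}\boxtimes\mathcal C\to\mathcal Z(\mathcal C)$ to the Drinfeld center is an equivalence. This functor sends $a\boxtimes b$ to $a\otimes b$, with half-braiding given on $a$ by the inverse braiding and on $b$ by the braiding. Objects of $\mathcal Z(\mathcal C)$ are pairs $(Z,\gamma)$ with half-braiding $\gamma_U\colon Z\otimes U\to U\otimes Z$, and the braiding of $\mathcal Z(\mathcal C)$ is $c_{(Z,\gamma),(W,\gamma')}=\gamma_W$. We suppress associators of $\mathcal C$ and $\mathcal Z(\mathcal C)$. A Frobenius algebra $F=(F,\mu,\eta,\Delta,\varepsilon)$ in $\mathcal C$ is an algebra and coalgebra with $(\mu\otimes\mathrm{id})(\mathrm{id}\otimes\Delta)=\Delta\mu=(\mathrm{id}\otimes\mu)(\Delta\otimes\mathrm{id})$.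 It is *special* if $\dim F\neq0$, $\mu\Delta=\mathrm{id}_F$ and $\varepsilon\eta=\dim(F)\,\mathrm{id}_{\mathbf 1}$. It is *symmetric* if $$\big((\varepsilon\mu)\otimes\mathrm{id}_{F^\vee}\big)\big(\mathrm{id}_F\otimes\mathrm{coev}^r_F\big)=\big(\mathrm{id}_{F^\vee}\otimes(\varepsilon\mu)\big)\big(\mathrm{coev}^l_F\otimes\mathrm{id}_F\big)\colon F\to F^\vee,$$ with $\mathrm{coev}^r_F\colon\mathbf 1\to F\otimes F^\vee$ and $\mathrm{coev}^l_F\colon\mathbf 1\to F^\vee\otimes F$ the right and (via the pivotal structure) left coevaluations. It is *simple* if it is simple as a bimodule over itself. For an algebra $A$, right $A$-modules form a left $\mathcal C$-module category $\mathrm{mod}\text{-}A$. For an $A$-$B$-bimodule $X$ let $G^X=-\otimes_AX\colon\mathrm{mod}\text{-}A\to\mathrm{mod}\text{-}B$, a $\mathcal C$-module functor. For $Z=(\dot Z,\gamma)\in\mathcal Z(\mathcal C)$ and a $\mathcal C$-module functor $G$, let $Z\rhd G$ be the functor $M\mapsto\dot Z\otimes G(M)$ made a $\mathcal C$-module functor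 via $\gamma$; thus $\mathcal C$-module functors and module natural transformations form a left $\mathcal Z(\mathcal C)$-module category. For $A$-$B$-bimodules $X,Y$ let $\mathbb D^{X,Y}\in\mathcal Z(\mathcal C)$ be the internal Hom of $G^X$ and $G^Y$ in this module category (*internal natural transformations*): it represents $Z\mapsto\mathrm{Hom}(Z\rhd G^X,G^Y)$; let $\mathrm{ev}_{X,Y}\colon\mathbb D^{X,Y}\rhd G^X\to G^Y$ be the universal transformation. *Vertical composition.* $\mu_{\mathrm{ver}}\colon\mathbb D^{Y,W}\otimes\mathbb D^{X,Y}\to\mathbb D^{X,W}$ is the canonical composition of internal Homs, i.e. the morphism corresponding to $\mathrm{ev}_{Y,W}\circ(\mathrm{id}\rhd\mathrm{ev}_{X,Y})$. *Left horizontal composition.* For $X_1,X_3\in A\text{-mod-}A'$ and $X_2,X_4\in A'\text{-mod-}A''$, $$\mu_{\mathrm{hor}}^{\mathrm{left}}\colon\mathbb D^{X_2,X_4}\otimes\mathbb D^{X_1,X_3}\to\mathbb D^{X_1\otimes_{A'}X_2,\;X_3\otimes_{A'}X_4}$$ is the morphism corresponding to the transformation with component at $M\in\mathrm{mod}\text{-}A$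 $$\mathbb D^{X_2,X_4}\otimes\mathbb D^{X_1,X_3}\otimes G^{X_2}G^{X_1}M\cong\mathbb D^{X_2,X_4}\otimes G^{X_2}(\mathbb D^{X_1,X_3}\otimes G^{X_1}M)\to\mathbb D^{X_2,X_4}\otimes G^{X_2}G^{X_3}M\to G^{X_4}G^{X_3}M,$$ the two arrows being $\mathrm{id}\otimes G^{X_2}(\mathrm{ev}_{X_1,X_3})$ and $\mathrm{ev}_{X_2,X_4}$ at $G^{X_3}M$, under the canonical isomorphisms $G^{Y}\circ G^{X}\cong G^{X\otimes_{A'}Y}$. **Theorem (internal Eckmann–Hilton relation).** Let $\mathcal C$ be a modular fusion category over $k$ and let $A,A',A''$ be simple special symmetric Frobenius algebras in $\mathcal C$. Then for all $X_1,X_3,X_5\in A\text{-mod-}A'$ and all $X_2,X_4,X_6\in A'\text{-mod-}A''$ the following two morphisms $$\mathbb D^{X_4,X_6}\otimes\mathbb D^{X_2,X_4}\otimes\mathbb D^{X_3,X_5}\otimes\mathbb D^{X_1,X_3}\longrightarrow\mathbb D^{X_1\otimes_{A'}X_2,\;X_5\otimes_{A'}X_6}$$ in $\mathcal Z(\mathcal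 C)$ are equal: $$\mu_{\mathrm{hor}}^{\mathrm{left}}\circ(\mu_{\mathrm{ver}}\otimes\mu_{\mathrm{ver}})=\mu_{\mathrm{ver}}\circ(\mu_{\mathrm{hor}}^{\mathrm{left}}\otimes\mu_{\mathrm{hor}}^{\mathrm{left}})\circ\big(\mathrm{id}\otimes c_{\mathbb D^{X_2,X_4},\,\mathbb D^{X_3,X_5}}\otimes\mathrm{id}\big),$$ where $c_{\mathbb D^{X_2,X_4},\,\mathbb D^{X_3,X_5}}$ is the half-braiding of $\mathbb D^{X_2,X_4}$ at $\mathbb D^{X_3,X_5}$. -/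

import Mathlib

open CategoryTheory MonoidalCategory Limits MonoidalLeftAction
open Functor.LaxLeftLinear Functor.OplaxLeftLinear Functor.LeftLinear

set_option linter.unusedSectionVars false
set_option linter.unusedVariables false
set_option linter.style.longLine false

universe w v u v₁ u₁ v₂ u₂ v₃ u₃

noncomputable section

attribute [local instance] Abelian.hasFiniteBiproducts

/-- A `C`-module functor structure on `F` built from natural isomorphisms
`c ⊙ F m ≅ F (c ⊙ m)` that satisfy the associativity and unit conditions. -/
@[reducible] def leftLinearMk {C : Type u} [Category.{v} C] [MonoidalCategory C]
    {M : Type u₁} [Category.{v₁} M] [MonoidalLeftAction C M]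
    {N : Type u₂} [Category.{v₂} N] [MonoidalLeftAction C N] (F : M ⥤ N)
    (e : ∀ (c : C) (m : M), c ⊙ₗ F.obj m ≅ F.obj (c ⊙ₗ m))
    (nat_left : ∀ {c c' : C} (f : c ⟶ c') (m : M),
      f ⊵ₗ F.obj m ≫ (e c' m).hom = (e c m).hom ≫ F.map (f ⊵ₗ m))
    (nat_right : ∀ (c : C) {m m' : M} (f : m ⟶ m'),
      c ⊴ₗ F.map f ≫ (e c m').hom = (e c m).hom ≫ F.map (c ⊴ₗ f))
    (assoc : ∀ (c c' : C) (m : M), (e (c ⊗ c') m).hom ≫ F.map (αₗ c c' m).hom =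
      (αₗ c c' (F.obj m)).hom ≫ c ⊴ₗ (e c' m).hom ≫ (e c (c' ⊙ₗ m)).hom)
    (unit : ∀ m : M, (λₗ (F.obj m)).hom = (e (𝟙_ C) m).hom ≫ F.map (λₗ m).hom) :
    F.LeftLinear C where
  μₗ c m := (e c m).hom
  δₗ c m := (e c m).inv
  μₗ_naturality_left := nat_left
  μₗ_naturality_right := nat_right
  μₗ_associativity := assoc
  μₗ_unitality := unit
  δₗ_naturality_left f m := by
    rw [← cancel_epi (e _ m).hom, ← reassoc_of% (nat_left f m)]; simp
  δₗ_naturality_right c _ _ f := by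
    rw [← cancel_epi (e c _).hom, ← reassoc_of% (nat_right c f)]; simp
  δₗ_associativity c c' m := by
    rw [← cancel_epi (e _ m).hom, reassoc_of% (assoc c c' m)]
    simp [← actionHomRight_comp]
  δₗ_unitality_inv m := by
    rw [← cancel_epi (λₗ[C] (F.obj m)).hom]
    nth_rw 2 [unit m]
    simp [← Functor.map_comp_assoc]
  μₗ_comp_δₗ := by simp
  δₗ_comp_μₗ := by simp

/-- A `C`-module functor between left module categories. -/
structure ModFun (C : Type u) [Category.{v} C] [MonoidalCategory C]
    (M : Type u₁) [Category.{v₁} M] [MonoidalLeftAction C M]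
    (N : Type u₂) [Category.{v₂} N] [MonoidalLeftAction C N] where
  F : M ⥤ N
  lin : F.LeftLinear C

namespace ModFun
variable {C : Type u} [Category.{v} C] [MonoidalCategory C]
    {M : Type u₁} [Category.{v₁} M] [MonoidalLeftAction C M]
    {N : Type u₂} [Category.{v₂} N] [MonoidalLeftAction C N]
    {P : Type u₃} [Category.{v₃} P] [MonoidalLeftAction C P]

attribute [instance] ModFun.lin

/-- A module natural transformation. -/
@[ext]
structure Hom (G H : ModFun C M N) where
  τ : G.F ⟶ H.F
  comm : ∀ (c : C) (m : M),
    μₗ G.F c m ≫ τ.app (c ⊙ₗ m) = c ⊴ₗ τ.app m ≫ μₗ H.F c m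

instance : Category (ModFun C M N) where
  Hom := Hom
  id G := ⟨𝟙 _, by simp⟩
  comp f g := ⟨f.τ ≫ g.τ, fun c m => by simp [reassoc_of% f.comm, g.comm]⟩

@[ext]
lemma hom_ext {G H : ModFun C M N} (f g : G ⟶ H) (h : ∀ m, f.τ.app m = g.τ.app m) : f = g :=
  Hom.ext (NatTrans.ext (funext h))

@[simp] lemma id_τ (G : ModFun C M N) : Hom.τ (𝟙 G) = 𝟙 G.F := rfl
@[simp] lemma comp_τ {G H K : ModFun C M N} (f : G ⟶ H) (g : H ⟶ K) :
    Hom.τ (f ≫ g) = f.τ ≫ g.τ := rfl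

/-- An isomorphism of module functors from a natural isomorphism that is a module
transformation. -/
def isoMk {G H : ModFun C M N} (e : G.F ≅ H.F) (h : ∀ (c : C) (m : M),
    μₗ G.F c m ≫ e.hom.app (c ⊙ₗ m) = c ⊴ₗ e.hom.app m ≫ μₗ H.F c m) : G ≅ H where
  hom := ⟨e.hom, h⟩
  inv := ⟨e.inv, fun c m => by
    rw [← cancel_mono (e.hom.app _), ← cancel_epi (c ⊴ₗ e.hom.app m)]
    simp [← actionHomRight_comp_assoc, h c m]⟩
  hom_inv_id := by ext; simp
  inv_hom_id := by ext; simp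

theorem half_unit {X : C} (b : HalfBraiding X) :
    (b.β (𝟙_ C)).hom = (ρ_ X).hom ≫ (λ_ X).inv := by
  have h := b.monoidal (𝟙_ C) (𝟙_ C)
  have h2 := b.naturality (λ_ (𝟙_ C)).hom
  rw [h] at h2
  have h5 : X ◁ (λ_ (𝟙_ C)).hom = (α_ _ _ _).inv ≫ (ρ_ _).hom := by monoidal
  have h4 : (λ_ (𝟙_ C)).hom ▷ X = (α_ _ _ _).hom ≫ (λ_ _).hom := by monoidal
  rw [h5, h4] at h2
  simp only [Category.assoc, Iso.cancel_iso_inv_left, Iso.inv_hom_id_assoc] at h2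
  rw [← rightUnitor_naturality, cancel_epi, leftUnitor_naturality] at h2
  rw [← cancel_epi (λ_ (X ⊗ 𝟙_ C)).hom, ← cancel_epi (α_ (𝟙_ C) X (𝟙_ C)).hom, ← h2]
  monoidal

theorem half_unit_inv {X : C} (b : HalfBraiding X) :
    (b.β (𝟙_ C)).inv = (λ_ X).hom ≫ (ρ_ X).inv := by
  rw [← cancel_epi (b.β (𝟙_ C)).hom, Iso.hom_inv_id, half_unit b]; simp

theorem half_nat_inv {X : C} (b : HalfBraiding X) {U V : C} (f : U ⟶ V) :
    f ▷ X ≫ (b.β V).inv = (b.β U).inv ≫ X ◁ f := by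
  rw [← cancel_epi (b.β U).hom, ← HalfBraiding.naturality_assoc]; simp

theorem half_monoidal_inv {X : C} (b : HalfBraiding X) (U V : C) :
    (b.β (U ⊗ V)).inv = (α_ _ _ _).hom ≫ U ◁ (b.β V).inv ≫ (α_ _ _ _).inv ≫
      (b.β U).inv ▷ V ≫ (α_ _ _ _).hom := by
  rw [← cancel_epi (b.β (U ⊗ V)).hom, Iso.hom_inv_id, HalfBraiding.monoidal]; simp

theorem act_exch_inv (x y : C) {n n' : N} (g : n ⟶ n') :
    x ⊴ₗ y ⊴ₗ g ≫ (αₗ x y n').inv = (αₗ x y n).inv ≫ (x ⊗ y) ⊴ₗ g := by simp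

theorem act_exch (x y : C) {n n' : N} (g : n ⟶ n') :
    (x ⊗ y) ⊴ₗ g ≫ (αₗ x y n').hom = (αₗ x y n).hom ≫ x ⊴ₗ y ⊴ₗ g := by simp

theorem act_coh₁ (x y z : C) (n : N) :
    (αₗ (x ⊗ y) z n).inv ≫ (α_ x y z).hom ⊵ₗ n ≫ (αₗ x (y ⊗ z) n).hom =
      (αₗ x y (z ⊙ₗ n)).hom ≫ x ⊴ₗ (αₗ y z n).inv := by
  rw [Iso.inv_comp_eq, ← associator_actionHom_assoc]; simp

theorem act_coh₂ (x y z : C) (n : N) :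
    (αₗ x (y ⊗ z) n).inv ≫ (α_ x y z).inv ⊵ₗ n ≫ (αₗ (x ⊗ y) z n).hom =
      x ⊴ₗ (αₗ y z n).hom ≫ (αₗ x y (z ⊙ₗ n)).inv := by
  rw [Iso.inv_comp_eq, ← cancel_epi ((α_ x y z).hom ⊵ₗ n), associator_actionHom_assoc]; simp

theorem act_coh₃ (x y z : C) (n : N) :
    (αₗ (x ⊗ y) z n).inv ≫ (α_ x y z).hom ⊵ₗ n ≫ (αₗ x (y ⊗ z) n).hom ≫
      x ⊴ₗ (αₗ y z n).hom = (αₗ x y (z ⊙ₗ n)).hom := by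
  rw [Iso.inv_comp_eq, associator_actionHom]

/-- The functor `m ↦ X ⊙ G m`, made a `C`-module functor with the help of a half-braiding
on `X`. -/
def actObj {X : C} (b : HalfBraiding X) (G : ModFun C M N) : ModFun C M N where
  F :=
    { obj m := X ⊙ₗ G.F.obj m
      map f := X ⊴ₗ G.F.map f }
  lin := leftLinearMk _ (fun c m =>
      (αₗ c X (G.F.obj m)).symm ≪≫
      { hom := (b.β c).inv ⊵ₗ G.F.obj m
        inv := (b.β c).hom ⊵ₗ G.F.obj m
        hom_inv_id := by simp [← comp_actionHomLeft]
        inv_hom_id := by simp [← comp_actionHomLeft] } ≪≫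
      (αₗ X c (G.F.obj m)) ≪≫
      { hom := X ⊴ₗ μₗ G.F c m
        inv := X ⊴ₗ δₗ G.F c m
        hom_inv_id := by simp [← actionHomRight_comp]
        inv_hom_id := by simp [← actionHomRight_comp] })
    (fun {c c'} f m => by
      dsimp
      simp only [Category.assoc]
      rw [← actionHomRight_comp, ← μₗ_naturality_left, actionHomRight_comp,
        actionHomLeft_action]
      simp only [Category.assoc, Iso.hom_inv_id_assoc, Iso.cancel_iso_inv_left]
      rw [← comp_actionHomLeft_assoc, half_nat_inv]
      simp)
    (fun c {m m'} f => by
      dsimp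
      simp only [Category.assoc]
      rw [← actionHomRight_comp, ← μₗ_naturality_right, actionHomRight_comp]
      rw [reassoc_of% @act_exch_inv, action_exchange_assoc, reassoc_of% @act_exch])
    (fun c c' m => by
      dsimp
      simp only [Category.assoc, half_monoidal_inv]
      rw [← actionHomRight_comp, μₗ_associativity]
      simp only [comp_actionHomLeft, actionHomRight_comp, whiskerLeft_actionHomLeft, whiskerRight_actionHomLeft, Category.assoc]
      rw [reassoc_of% @act_coh₁, reassoc_of% @act_coh₂, reassoc_of% @act_coh₃, reassoc_of% @act_exch_inv,
        action_exchange_assoc, reassoc_of% @act_exch])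
    (fun m => by
      dsimp
      simp only [Category.assoc, half_unit_inv]
      rw [← actionHomRight_comp, ← μₗ_unitality]
      simp [-μₗ_unitality, ← rightUnitor_actionHom, ← comp_actionHomLeft])

/-- The module functor `Z ⊙ G` for `Z` in the Drinfeld center. -/
def act (Z : Center C) (G : ModFun C M N) : ModFun C M N := actObj Z.2 G

theorem actObj_obj {X : C} (b : HalfBraiding X) (G : ModFun C M N) (m : M) :
    (actObj b G).F.obj m = X ⊙ₗ G.F.obj m := rfl

theorem actObj_μ {X : C} (b : HalfBraiding X) (G : ModFun C M N) (c : C) (m : M) :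
    μₗ (actObj b G).F c m = (αₗ c X (G.F.obj m)).inv ≫ (b.β c).inv ⊵ₗ G.F.obj m ≫
      (αₗ X c (G.F.obj m)).hom ≫ X ⊴ₗ μₗ G.F c m := rfl

/-- The module transformation `X ⊙ G ⟶ Y ⊙ G` induced by a morphism `X ⟶ Y` compatible with
half-braidings. -/
def actLeft {X Y : C} (b : HalfBraiding X) (b' : HalfBraiding Y) (f : X ⟶ Y)
    (hf : ∀ U : C, f ▷ U ≫ (b'.β U).hom = (b.β U).hom ≫ U ◁ f) (G : ModFun C M N) :
    actObj b G ⟶ actObj b' G where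
  τ := { app m := f ⊵ₗ G.F.obj m
         naturality m m' g := action_exchange _ _ }
  comm c m := by
    have h : c ◁ f ≫ (b'.β c).inv = (b.β c).inv ≫ f ▷ c := by
      rw [← cancel_epi (b.β c).hom, Iso.hom_inv_id_assoc, ← Category.assoc, Iso.comp_inv_eq, hf]
    change _ ≫ f ⊵ₗ G.F.obj (c ⊙ₗ m) = c ⊴ₗ f ⊵ₗ G.F.obj m ≫ _
    rw [actObj_μ, actObj_μ]
    have h1 : c ⊴ₗ f ⊵ₗ G.F.obj m ≫ (αₗ c Y (G.F.obj m)).inv =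
      (αₗ c X (G.F.obj m)).inv ≫ (c ◁ f) ⊵ₗ G.F.obj m := by simp
    rw [reassoc_of% h1, ← comp_actionHomLeft_assoc, h]
    simp only [Category.assoc, action_exchange]
    simp

/-- The module transformation `X ⊙ G ⟶ X ⊙ H` induced by `G ⟶ H`. -/
def actRight {X : C} (b : HalfBraiding X) {G H : ModFun C M N} (f : G ⟶ H) : actObj b G ⟶ actObj b H where
  τ := { app m := X ⊴ₗ f.τ.app m
         naturality m m' g := by
          change X ⊴ₗ G.F.map g ≫ X ⊴ₗ f.τ.app m' = X ⊴ₗ f.τ.app m ≫ X ⊴ₗ H.F.map g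
          simp [← actionHomRight_comp] }
  comm c m := by
    change _ ≫ X ⊴ₗ f.τ.app (c ⊙ₗ m) = c ⊴ₗ X ⊴ₗ f.τ.app m ≫ _
    rw [actObj_μ, actObj_μ]
    simp only [Category.assoc]
    rw [← actionHomRight_comp, f.comm, reassoc_of% @act_exch_inv, action_exchange_assoc,
      reassoc_of% @act_exch, ← actionHomRight_comp]

theorem comm_unit (G : ModFun C M N) (b : HalfBraiding (𝟙_ C)) (hb : ∀ U, (b.β U).hom = (λ_ U).hom ≫ (ρ_ U).inv)
    (c : C) (m : M) :
    μₗ (actObj b G).F c m ≫ (λₗ (G.F.obj (c ⊙ₗ m))).hom = c ⊴ₗ (λₗ (G.F.obj m)).hom ≫ μₗ G.F c m := by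
  have hb' : (b.β c).inv = (ρ_ c).hom ≫ (λ_ c).inv := by
    rw [← cancel_epi (b.β c).hom, Iso.hom_inv_id, hb]; simp
  have h1 : (λ_ c).inv ⊵ₗ G.F.obj m = (λₗ _).inv ≫ (αₗ _ _ _).inv := by
    rw [← cancel_epi ((λ_ c).hom ⊵ₗ G.F.obj m), ← comp_actionHomLeft]; simp
  rw [actObj_μ, hb', comp_actionHomLeft, rightUnitor_actionHom, h1]
  simp [actObj_obj, -μₗ_unitality, -δₗ_unitality_inv]

theorem comm_assoc (G : ModFun C M N) {X Y : C} (b : HalfBraiding X) (b' : HalfBraiding Y)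
    (b'' : HalfBraiding (X ⊗ Y))
    (hb : ∀ U, (b''.β U).inv = (α_ _ _ _).inv ≫ (b.β U).inv ▷ Y ≫ (α_ _ _ _).hom ≫
      X ◁ (b'.β U).inv ≫ (α_ _ _ _).inv) (c : C) (m : M) :
    μₗ (actObj b'' G).F c m ≫ (αₗ X Y (G.F.obj (c ⊙ₗ m))).hom =
      c ⊴ₗ (αₗ X Y (G.F.obj m)).hom ≫ μₗ (actObj b (actObj b' G)).F c m := by
  rw [actObj_μ, actObj_μ, actObj_μ, hb]
  simp only [comp_actionHomLeft, actionHomRight_comp, whiskerLeft_actionHomLeft, whiskerRight_actionHomLeft, Category.assoc, actObj_obj]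
  rw [reassoc_of% @act_coh₂, reassoc_of% @act_coh₁, reassoc_of% @act_coh₂, act_exch]
  simp

theorem tensor_inv (Z W : Center C) (U : C) : ((Z ⊗ W).2.β U).inv =
   (α_ _ _ _).inv ≫ (Z.2.β U).inv ▷ W.1 ≫ (α_ _ _ _).hom ≫
      Z.1 ◁ (W.2.β U).inv ≫ (α_ _ _ _).inv := by
  rw [Center.tensor_β]
  simp

/-- The category of `C`-module functors is a left module category over the Drinfeld center. -/
instance : MonoidalLeftAction (Center C) (ModFun C M N) where
  actionObj := act
  actionHomLeft f G := actLeft _ _ f.f f.comm G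
  actionHomRight Z {_ _} f := actRight Z.2 f
  actionAssocIso Z W G := isoMk (NatIso.ofComponents (fun m => αₗ Z.1 W.1 (G.F.obj m))
    (fun f => act_exch _ _ _)) (comm_assoc G Z.2 W.2 (Z ⊗ W).2 (tensor_inv Z W))
  actionUnitIso G := isoMk (NatIso.ofComponents (fun m => λₗ (G.F.obj m))
    (fun f => (actionUnitIso_hom_naturality _).symm)) (comm_unit G (𝟙_ (Center C)).2 (fun _ => rfl))
  actionHomRight_id Z G := by ext m; exact actionHomRight_id _ _
  id_actionHomLeft Z G := by ext m; exact id_actionHomLeft _ _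
  actionHom_comp f₁ f₂ g₁ g₂ := by
    ext m
    have := actionHom_comp f₁.f f₂.f (g₁.τ.app m) (g₂.τ.app m)
    simp only [actionHom_def] at this
    exact this
  actionAssocIso_hom_naturality f g h := by
    ext m
    have := actionAssocIso_hom_naturality f.f g.f (h.τ.app m)
    simp only [actionHom_def, MonoidalCategory.tensorHom_def] at this ⊢
    exact this
  actionUnitIso_hom_naturality f := by ext m; exact actionUnitIso_hom_naturality _
  whiskerLeft_actionHomLeft Z W V f G := by ext m; exact whiskerLeft_actionHomLeft _ _ _
  whiskerRight_actionHomLeft V f G := by ext m; exact whiskerRight_actionHomLeft _ _ _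
  associator_actionHom := by intros; ext m; exact associator_actionHom _ _ _ _
  leftUnitor_actionHom := by intros; ext m; exact leftUnitor_actionHom _ _
  rightUnitor_actionHom := by intros; ext m; exact rightUnitor_actionHom _ _

/-- Composition of module functors, `G` first. -/
def comp (G : ModFun C M N) (H : ModFun C N P) : ModFun C M P where
  F := G.F ⋙ H.F
  lin := leftLinearMk _ (fun c m => μₗIso H.F c (G.F.obj m) ≪≫ H.F.mapIso (μₗIso G.F c m))
    (fun f m => by simp [← Functor.map_comp])
    (fun c {m m'} f => by simp [← Functor.map_comp])
    (fun c c' m => by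
      dsimp
      simp only [Category.assoc, actionHomRight_comp, μₗ_naturality_right_assoc, ← Functor.map_comp, ← μₗ_associativity_assoc, μₗ_associativity])
    (fun m => by simp [← Functor.map_comp])

theorem comp_μ (G : ModFun C M N) (H : ModFun C N P) (c : C) (m : M) :
    μₗ (comp G H).F c m = μₗ H.F c (G.F.obj m) ≫ H.F.map (μₗ G.F c m) := rfl

/-- The transformation with components `f` at `G m`. -/
def whiskerL (G : ModFun C M N) {H K : ModFun C N P} (f : H ⟶ K) : comp G H ⟶ comp G K where
  τ := Functor.whiskerLeft G.F f.τ
  comm c m := by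
    rw [comp_μ, comp_μ]
    change _ ≫ f.τ.app _ = c ⊴ₗ f.τ.app _ ≫ _
    simp [reassoc_of% f.comm]

/-- The transformation with components `K (f m)`. -/
def whiskerR {G H : ModFun C M N} (f : G ⟶ H) (K : ModFun C N P) : comp G K ⟶ comp H K where
  τ := Functor.whiskerRight f.τ K.F
  comm c m := by
    rw [comp_μ, comp_μ]
    change _ ≫ K.F.map (f.τ.app _) = c ⊴ₗ K.F.map (f.τ.app _) ≫ _
    simp [← Functor.map_comp, f.comm]

/-- The module constraint of `H` as a transformation `Z ⊙ (G then H) ⟶ (Z ⊙ G) then H`. -/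
def actComp (Z : Center C) (G : ModFun C M N) (H : ModFun C N P) : Z ⊙ₗ comp G H ⟶ comp (Z ⊙ₗ G) H where
  τ := { app m := μₗ H.F Z.1 (G.F.obj m)
         naturality m m' f := μₗ_naturality_right H.F Z.1 (G.F.map f) }
  comm c m := by
    have key : ∀ {X : C} (b : HalfBraiding X),
        ((αₗ c X (H.F.obj (G.F.obj m))).inv ≫ (b.β c).inv ⊵ₗ H.F.obj (G.F.obj m) ≫
          (αₗ X c (H.F.obj (G.F.obj m))).hom ≫ X ⊴ₗ (μₗ H.F c (G.F.obj m) ≫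
            H.F.map (μₗ G.F c m))) ≫ μₗ H.F X (G.F.obj (c ⊙ₗ m)) =
        c ⊴ₗ μₗ H.F X (G.F.obj m) ≫ μₗ H.F c (X ⊙ₗ G.F.obj m) ≫
          H.F.map ((αₗ c X (G.F.obj m)).inv ≫ (b.β c).inv ⊵ₗ G.F.obj m ≫
            (αₗ X c (G.F.obj m)).hom ≫ X ⊴ₗ μₗ G.F c m) := by
      intro X b
      simp only [Functor.map_comp, actionHomRight_comp, Category.assoc, μₗ_naturality_right,
        μₗ_associativity_inv_assoc, ← μₗ_naturality_left_assoc]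
      rw [← reassoc_of% (μₗ_associativity H.F X c (G.F.obj m))]
    exact key Z.2

/-- The identity, as a transformation `Z ⊙ (G then H) ⟶ G then (Z ⊙ H)`. -/
def compAct (Z : Center C) (G : ModFun C M N) (H : ModFun C N P) : Z ⊙ₗ comp G H ⟶ comp G (Z ⊙ₗ H) where
  τ := { app m := 𝟙 _
         naturality m m' f := (Category.comp_id _).trans (Category.id_comp _).symm }
  comm c m := by
    have key : ∀ {X : C} (b : HalfBraiding X),
        ((αₗ c X (H.F.obj (G.F.obj m))).inv ≫ (b.β c).inv ⊵ₗ H.F.obj (G.F.obj m) ≫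
          (αₗ X c (H.F.obj (G.F.obj m))).hom ≫ X ⊴ₗ (μₗ H.F c (G.F.obj m) ≫
            H.F.map (μₗ G.F c m))) ≫ 𝟙 (X ⊙ₗ H.F.obj (G.F.obj (c ⊙ₗ m))) =
        c ⊴ₗ 𝟙 (X ⊙ₗ H.F.obj (G.F.obj m)) ≫ ((αₗ c X (H.F.obj (G.F.obj m))).inv ≫
          (b.β c).inv ⊵ₗ H.F.obj (G.F.obj m) ≫ (αₗ X c (H.F.obj (G.F.obj m))).hom ≫
            X ⊴ₗ μₗ H.F c (G.F.obj m)) ≫ X ⊴ₗ H.F.map (μₗ G.F c m) := by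
      intro X b
      simp
    exact key Z.2

/-- The left horizontal composite of `f : Z ⊙ G₂ ⟶ G₄` and `g : W ⊙ G₁ ⟶ G₃`: its component at
`m` applies `G₂` to the component of `g` at `m` (using the module constraint of `G₂` to move `W`
past `G₂`), and then the component of `f` at `G₃ m`. -/
def hcompL (G₁ G₃ : ModFun C M N) (G₂ G₄ : ModFun C N P) (Z W : Center C) (f : Z ⊙ₗ G₂ ⟶ G₄) (g : W ⊙ₗ G₁ ⟶ G₃) :
   (Z ⊗ W) ⊙ₗ comp G₁ G₂ ⟶ comp G₃ G₄ :=
  (αₗ Z W (comp G₁ G₂)).hom ≫ Z ⊴ₗ actComp W G₁ G₂ ≫ Z ⊴ₗ whiskerR g G₂ ≫ compAct Z G₃ G₂ ≫ whiskerL G₃ f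
end ModFun

/-- An internal Hom object of `m` and `n` in a left module category over `V`: an object
representing `v ↦ (v ⊙ m ⟶ n)`. -/
structure InternalHom (V : Type u) [Category.{v} V] [MonoidalCategory V]
    {M : Type u₁} [Category.{v₁} M] [MonoidalLeftAction V M] (m n : M) where
  obj : V
  ev : obj ⊙ₗ m ⟶ n
  curry {v : V} (f : v ⊙ₗ m ⟶ n) : v ⟶ obj
  curry_ev {v : V} (f : v ⊙ₗ m ⟶ n) : curry f ⊵ₗ m ≫ ev = f
  uniq {v : V} (f : v ⊙ₗ m ⟶ n) (g : v ⟶ obj) : g ⊵ₗ m ≫ ev = f → g = curry f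

namespace InternalHom
variable {V : Type u} [Category.{v} V] [MonoidalCategory V]
    {M : Type u₁} [Category.{v₁} M] [MonoidalLeftAction V M]
/-- The canonical composition of internal Homs. -/
def mul {l m n : M} (a : InternalHom V m n) (b : InternalHom V l m) (c : InternalHom V l n) : a.obj ⊗ b.obj ⟶ c.obj :=
  c.curry ((αₗ _ _ _).hom ≫ a.obj ⊴ₗ b.ev ≫ a.ev)
end InternalHom

section Rigid
variable {C : Type u} [Category.{v} C] [MonoidalCategory C] [RigidCategory C]
instance (X : C) : PreservesColimitsOfSize.{0, 0} (tensorLeft X) :=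
  (tensorLeftAdjunction (ᘁX) X).leftAdjoint_preservesColimits
instance (X : C) : PreservesColimitsOfSize.{0, 0} (tensorRight X) :=
  (tensorRightAdjunction X Xᘁ).leftAdjoint_preservesColimits
end Rigid

/-- Right modules over an algebra `A`. -/
structure RightMod {C : Type u} [Category.{v} C] [MonoidalCategory C] (A : Mon C) where
  X : C
  act : X ⊗ A.X ⟶ X
  act_one : X ◁ MonObj.one ≫ act = (ρ_ X).hom
  act_mul : X ◁ MonObj.mul ≫ act = (α_ X A.X A.X).inv ≫ act ▷ A.X ≫ act

namespace RightMod
section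
variable {C : Type u} [Category.{v} C] [MonoidalCategory C] {A B : Mon C}

/-- Morphisms of right modules. -/
@[ext]
structure Hom (M N : RightMod A) where
  hom : M.X ⟶ N.X
  comm : M.act ≫ hom = hom ▷ A.X ≫ N.act

instance : Category (RightMod A) where
  Hom := Hom
  id M := ⟨𝟙 _, by simp⟩
  comp f g := ⟨f.hom ≫ g.hom, by simp [reassoc_of% f.comm, g.comm]⟩

@[ext]
lemma hom_ext {M N : RightMod A} (f g : M ⟶ N) (h : f.hom = g.hom) : f = g :=
  Hom.ext h

@[simp] lemma id_hom (M : RightMod A) : Hom.hom (𝟙 M) = 𝟙 M.X := rfl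
@[simp] lemma comp_hom {M N K : RightMod A} (f : M ⟶ N) (g : N ⟶ K) :
    Hom.hom (f ≫ g) = f.hom ≫ g.hom := rfl

@[simps]
def isoMk {M N : RightMod A} (e : M.X ≅ N.X) (h : M.act ≫ e.hom = e.hom ▷ A.X ≫ N.act) : M ≅ N where
  hom := ⟨e.hom, h⟩
  inv := ⟨e.inv, by
    rw [← cancel_mono e.hom, ← cancel_epi (e.hom ▷ A.X)]
    simp [h]⟩
  hom_inv_id := by ext; simp
  inv_hom_id := by ext; simp

/-- The right module `c ⊗ M`. -/
abbrev smul (c : C) (M : RightMod A) : RightMod A where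
  X := c ⊗ M.X
  act := (α_ c M.X A.X).hom ≫ c ◁ M.act
  act_one := by
    rw [associator_naturality_right_assoc, ← MonoidalCategory.whiskerLeft_comp, M.act_one]
    monoidal
  act_mul := by
    rw [associator_naturality_right_assoc, ← MonoidalCategory.whiskerLeft_comp, M.act_mul]
    simp

/-- Right modules form a left module category over `C`. -/
instance : MonoidalLeftAction C (RightMod A) where
  actionObj := smul
  actionHomLeft f M := ⟨f ▷ M.X, by simp [smul, whisker_exchange]⟩
  actionHomRight c {M N} f := ⟨c ◁ f.hom, by
    simp [← MonoidalCategory.whiskerLeft_comp, f.comm]⟩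
  actionAssocIso c d M := isoMk (α_ c d M.X) (by simp [smul])
  actionUnitIso M := isoMk (λ_ M.X) (by simp [smul])
  actionHom_comp f₁ f₂ g₁ g₂ := by
    ext
    have := MonoidalCategory.tensorHom_comp_tensorHom f₁ g₁.hom f₂ g₂.hom
    simp only [MonoidalCategory.tensorHom_def] at this
    exact this.symm
  actionHomRight_id c M := by ext; exact MonoidalCategory.whiskerLeft_id _ _
  id_actionHomLeft c M := by ext; exact MonoidalCategory.id_whiskerRight _ _
  actionAssocIso_hom_naturality f g h := by
    ext
    have := MonoidalCategory.associator_naturality f g h.hom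
    simp only [MonoidalCategory.tensorHom_def] at this ⊢
    exact this
  actionUnitIso_hom_naturality f := by ext; exact (leftUnitor_naturality f.hom).symm
  whiskerLeft_actionHomLeft c _ _ f M := by ext; exact whisker_assoc _ _ _
  whiskerRight_actionHomLeft c f M := by ext; exact MonoidalCategory.whiskerRight_tensor_symm _ _ _
  associator_actionHom c₁ c₂ c₃ M := by ext; exact pentagon _ _ _ _
  leftUnitor_actionHom c M := by ext; exact leftUnitor_whiskerRight _ _
  rightUnitor_actionHom c M := by ext; exact (MonoidalCategory.triangle c M.X).symm

end
section
variable {C : Type u} [Category.{v} C] [MonoidalCategory C] [RigidCategory C] [HasCoequalizers C]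
  {A B D : Mon C}

/-- The object `M ⊗_A X`. -/
def tens (M : RightMod A) (X : Bimod A B) : C :=
  coequalizer (M.act ▷ X.X) ((α_ M.X A.X X.X).hom ≫ M.X ◁ X.actLeft)

/-- The projection onto `M ⊗_A X`. -/
def pr (M : RightMod A) (X : Bimod A B) : M.X ⊗ X.X ⟶ tens M X :=
  coequalizer.π (M.act ▷ X.X) ((α_ M.X A.X X.X).hom ≫ M.X ◁ X.actLeft)

theorem pr_cond (M : RightMod A) (X : Bimod A B) : M.act ▷ X.X ≫ pr M X = (α_ M.X A.X X.X).hom ≫ M.X ◁ X.actLeft ≫ pr M X := by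
  have := coequalizer.condition (M.act ▷ X.X) ((α_ M.X A.X X.X).hom ≫ M.X ◁ X.actLeft)
  rw [Category.assoc] at this
  exact this

instance (M : RightMod A) (X : Bimod A B) : Epi (pr M X) :=
  coequalizer.π_epi
instance (M : RightMod A) (X : Bimod A B) (c : C) : Epi (c ◁ pr M X) :=
  inferInstanceAs (Epi ((tensorLeft c).map (pr M X)))
instance (M : RightMod A) (X : Bimod A B) (c d : C) : Epi ((c ◁ pr M X) ▷ d) :=
  inferInstanceAs (Epi ((tensorRight d).map ((tensorLeft c).map (pr M X))))
instance (M : RightMod A) (X : Bimod A B) (c d : C) : Epi (c ◁ d ◁ pr M X) :=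
  inferInstanceAs (Epi ((tensorLeft c).map ((tensorLeft d).map (pr M X))))
instance (M : RightMod A) (X : Bimod A B) (c d : C) : Epi (pr M X ▷ c ▷ d) :=
  inferInstanceAs (Epi ((tensorRight d).map ((tensorRight c).map (pr M X))))
instance (M : RightMod A) (X : Bimod A B) (c : C) : Epi (pr M X ▷ c) :=
  inferInstanceAs (Epi ((tensorRight c).map (pr M X)))

def desc (M : RightMod A) (X : Bimod A B) {W : C} (h : M.X ⊗ X.X ⟶ W)
    (wh : M.act ▷ X.X ≫ h = (α_ M.X A.X X.X).hom ≫ M.X ◁ X.actLeft ≫ h) : tens M X ⟶ W :=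
  coequalizer.desc h (by simpa using wh)

@[simp]
theorem pr_desc (M : RightMod A) (X : Bimod A B) {W : C} (h : M.X ⊗ X.X ⟶ W)
    (wh : M.act ▷ X.X ≫ h = (α_ M.X A.X X.X).hom ≫ M.X ◁ X.actLeft ≫ h) : pr M X ≫ desc M X h wh = h :=
  coequalizer.π_desc _ _

def descL (c : C) (M : RightMod A) (X : Bimod A B) {W : C} (h : c ⊗ M.X ⊗ X.X ⟶ W)
    (wh : c ◁ M.act ▷ X.X ≫ h = c ◁ (α_ M.X A.X X.X).hom ≫ c ◁ M.X ◁ X.actLeft ≫ h) : c ⊗ tens M X ⟶ W :=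
  (PreservesCoequalizer.iso (tensorLeft c) _ _).inv ≫ coequalizer.desc h (by simpa using wh)

@[simp]
theorem pr_descL (c : C) (M : RightMod A) (X : Bimod A B) {W : C} (h : c ⊗ M.X ⊗ X.X ⟶ W)
    (wh : c ◁ M.act ▷ X.X ≫ h = c ◁ (α_ M.X A.X X.X).hom ≫ c ◁ M.X ◁ X.actLeft ≫ h) :
    c ◁ pr M X ≫ descL c M X h wh = h :=
  id_tensor_π_preserves_coequalizer_inv_desc _ _ _ _

def descR (c : C) (M : RightMod A) (X : Bimod A B) {W : C} (h : (M.X ⊗ X.X) ⊗ c ⟶ W)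
    (wh : M.act ▷ X.X ▷ c ≫ h = (α_ M.X A.X X.X).hom ▷ c ≫ (M.X ◁ X.actLeft) ▷ c ≫ h) : tens M X ⊗ c ⟶ W :=
  (PreservesCoequalizer.iso (tensorRight c) _ _).inv ≫ coequalizer.desc h (by simpa using wh)

@[simp]
theorem pr_descR (c : C) (M : RightMod A) (X : Bimod A B) {W : C} (h : (M.X ⊗ X.X) ⊗ c ⟶ W)
    (wh : M.act ▷ X.X ▷ c ≫ h = (α_ M.X A.X X.X).hom ▷ c ≫ (M.X ◁ X.actLeft) ▷ c ≫ h) :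
    pr M X ▷ c ≫ descR c M X h wh = h :=
  π_tensor_id_preserves_coequalizer_inv_desc _ _ _ _

/-- `M ⊗_A X` as a right module. -/
abbrev tensMod (M : RightMod A) (X : Bimod A B) : RightMod B where
  X := tens M X
  act := descR B.X M X ((α_ _ _ _).hom ≫ M.X ◁ X.actRight ≫ pr M X) (by
    simp only [associator_naturality_left_assoc]
    rw [← whisker_exchange_assoc, pr_cond]
    simp only [associator_naturality_middle_assoc, ← MonoidalCategory.whiskerLeft_comp_assoc,
      X.middle_assoc]
    simp)
  act_one := by
    rw [← cancel_epi (pr M X ▷ 𝟙_ C), ← whisker_exchange_assoc, pr_descR,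
      associator_naturality_right_assoc, ← MonoidalCategory.whiskerLeft_comp_assoc,
      X.actRight_one, rightUnitor_naturality]
    monoidal
  act_mul := by
    rw [← cancel_epi (pr M X ▷ (B.X ⊗ B.X)), ← whisker_exchange_assoc, pr_descR,
      associator_naturality_right_assoc, ← MonoidalCategory.whiskerLeft_comp_assoc,
      X.right_assoc, associator_inv_naturality_left_assoc, ← comp_whiskerRight_assoc, pr_descR]
    simp

theorem pr_act (M : RightMod A) (X : Bimod A B) : pr M X ▷ B.X ≫ (tensMod M X).act =
    (α_ _ _ _).hom ≫ M.X ◁ X.actRight ≫ pr M X := by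
  rw [pr_descR]

def tensMap {M N : RightMod A} (f : M ⟶ N) (X : Bimod A B) : tensMod M X ⟶ tensMod N X where
  hom := desc M X (f.hom ▷ X.X ≫ pr N X) (by
    rw [← MonoidalCategory.comp_whiskerRight_assoc, f.comm, MonoidalCategory.comp_whiskerRight_assoc, pr_cond]
    simp [whisker_exchange_assoc])
  comm := by
    change (tensMod M X).act ≫ desc M X _ _ = desc M X _ _ ▷ B.X ≫ _
    rw [← cancel_epi (pr M X ▷ B.X), reassoc_of% @pr_act, pr_desc, ← comp_whiskerRight_assoc, pr_desc,
      comp_whiskerRight_assoc, pr_act]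
    simp [whisker_exchange_assoc]

theorem pr_map {M N : RightMod A} (f : M ⟶ N) (X : Bimod A B) :
    pr M X ≫ (tensMap f X).hom = f.hom ▷ X.X ≫ pr N X := by
  rw [tensMap, pr_desc]

@[ext]
theorem tens_ext {M : RightMod A} {X : Bimod A B} {W : C} (f g : tens M X ⟶ W) (h : pr M X ≫ f = pr M X ≫ g) : f = g :=
  (cancel_epi _).1 h

def tensFunctor (X : Bimod A B) : RightMod A ⥤ RightMod B where
  obj M := tensMod M X
  map f := tensMap f X
  map_id M := by ext; rw [pr_map]; simp
  map_comp f g := by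
    ext
    rw [pr_map, comp_hom, comp_hom, reassoc_of% @pr_map, pr_map]; simp

theorem smul_pr_cond (c : C) (M : RightMod A) (X : Bimod A B) :
    c ◁ M.act ▷ X.X ≫ (α_ c M.X X.X).inv ≫ pr (c ⊙ₗ M) X =
      c ◁ (α_ M.X A.X X.X).hom ≫ c ◁ M.X ◁ X.actLeft ≫ (α_ c M.X X.X).inv ≫ pr (c ⊙ₗ M) X := by
  have := pr_cond (c ⊙ₗ M) X
  change ((α_ c M.X A.X).hom ≫ c ◁ M.act) ▷ X.X ≫ pr (c ⊙ₗ M) X =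
    (α_ (c ⊗ M.X) A.X X.X).hom ≫ (c ⊗ M.X) ◁ X.actLeft ≫ pr (c ⊙ₗ M) X at this
  rw [← cancel_epi (α_ c (M.X ⊗ A.X) X.X).hom, ← cancel_epi ((α_ c M.X A.X).hom ▷ X.X)]
  simpa using this

theorem whisker_pr_cond (c : C) (M : RightMod A) (X : Bimod A B) :
    c ◁ M.act ▷ X.X ≫ c ◁ pr M X =
      c ◁ (α_ M.X A.X X.X).hom ≫ c ◁ M.X ◁ X.actLeft ≫ c ◁ pr M X := by
  simp only [← MonoidalCategory.whiskerLeft_comp, pr_cond]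

def tensLinIso (c : C) (M : RightMod A) (X : Bimod A B) :
    c ⊗ tens M X ≅ tens (c ⊙ₗ M) X where
  hom := descL c M X ((α_ _ _ _).inv ≫ pr (c ⊙ₗ M) X) (smul_pr_cond c M X)
  inv := desc (c ⊙ₗ M) X ((α_ _ _ _).hom ≫ c ◁ pr M X) (by
    change ((α_ c M.X A.X).hom ≫ c ◁ M.act) ▷ X.X ≫ (α_ c M.X X.X).hom ≫ c ◁ pr M X =
      (α_ (c ⊗ M.X) A.X X.X).hom ≫ (c ⊗ M.X) ◁ X.actLeft ≫ (α_ c M.X X.X).hom ≫ c ◁ pr M X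
    simp [whisker_pr_cond])
  hom_inv_id := by
    rw [← cancel_epi (c ◁ pr M X), reassoc_of% @pr_descL, Category.assoc, pr_desc]
    exact (Iso.inv_hom_id_assoc _ _).trans (Category.comp_id _).symm
  inv_hom_id := by
    rw [← cancel_epi (pr (c ⊙ₗ M) X), reassoc_of% @pr_desc, Category.assoc, pr_descL]
    exact (Iso.hom_inv_id_assoc _ _).trans (Category.comp_id _).symm

theorem pr_linIso (c : C) (M : RightMod A) (X : Bimod A B) :
    c ◁ pr M X ≫ (tensLinIso c M X).hom = (α_ _ _ _).inv ≫ pr (c ⊙ₗ M) X :=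
  pr_descL _ _ _ _ (smul_pr_cond c M X)

/-- The module constraint `c ⊗ (M ⊗_A X) ≅ (c ⊗ M) ⊗_A X`. -/
def tensLin (c : C) (M : RightMod A) (X : Bimod A B) :
    c ⊙ₗ tensMod M X ≅ tensMod (c ⊙ₗ M) X :=
  isoMk (tensLinIso c M X) (by
      change ((α_ c (tensMod M X).X B.X).hom ≫ c ◁ (tensMod M X).act) ≫ (tensLinIso c M X).hom =
        (tensLinIso c M X).hom ▷ B.X ≫ (tensMod (c ⊙ₗ M) X).act
      rw [← cancel_epi ((c ◁ pr M X) ▷ B.X), ← comp_whiskerRight_assoc, pr_linIso, Category.assoc,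
        associator_naturality_middle_assoc, ← MonoidalCategory.whiskerLeft_comp_assoc, pr_act,
        comp_whiskerRight_assoc, pr_act]
      simp only [MonoidalCategory.whiskerLeft_comp, Category.assoc]
      rw [pr_linIso]
      change _ = _ ≫ (α_ (c ⊗ M.X) X.X B.X).hom ≫ (c ⊗ M.X) ◁ X.actRight ≫ pr (c ⊙ₗ M) X
      simp)

theorem pr_lin (c : C) (M : RightMod A) (X : Bimod A B) :
    c ◁ pr M X ≫ (tensLin c M X).hom.hom = (α_ _ _ _).inv ≫ pr (c ⊙ₗ M) X :=
  pr_linIso c M X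

/-- The module functor `- ⊗_A X` from right `A`-modules to right `B`-modules. -/
def tensFun (X : Bimod A B) : ModFun C (RightMod A) (RightMod B) where
  F := tensFunctor X
  lin := leftLinearMk _ (fun c M => tensLin c M X)
    (fun {c c'} f M => by
      ext
      change f ▷ (tensMod M X).X ≫ (tensLin c' M X).hom.hom =
        (tensLin c M X).hom.hom ≫ (tensMap (f ⊵ₗ M) X).hom
      rw [← cancel_epi (c ◁ pr M X), whisker_exchange_assoc, pr_lin, reassoc_of% @pr_lin, pr_map]
      change _ = _ ≫ (f ▷ M.X) ▷ X.X ≫ _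
      simp)
    (fun c {M N} f => by
      ext
      change c ◁ (tensMap f X).hom ≫ (tensLin c N X).hom.hom =
        (tensLin c M X).hom.hom ≫ (tensMap (c ⊴ₗ f) X).hom
      rw [← cancel_epi (c ◁ pr M X), ← MonoidalCategory.whiskerLeft_comp_assoc, pr_map,
        MonoidalCategory.whiskerLeft_comp_assoc, pr_lin, reassoc_of% @pr_lin, pr_map]
      change _ = _ ≫ (c ◁ f.hom) ▷ X.X ≫ _
      simp)
    (fun c c' M => by
      ext
      change (tensLin (c ⊗ c') M X).hom.hom ≫ (tensMap (αₗ c c' M).hom X).hom =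
        (α_ c c' (tensMod M X).X).hom ≫ c ◁ (tensLin c' M X).hom.hom ≫ (tensLin c (c' ⊙ₗ M) X).hom.hom
      rw [← cancel_epi ((c ⊗ c') ◁ pr M X), reassoc_of% @pr_lin, pr_map,
        associator_naturality_right_assoc, ← MonoidalCategory.whiskerLeft_comp_assoc, pr_lin,
        MonoidalCategory.whiskerLeft_comp_assoc, pr_lin]
      change _ ≫ (α_ c c' M.X).hom ▷ X.X ≫ pr (c ⊙ₗ c' ⊙ₗ M) X = _ ≫ _ ≫ (α_ c (c' ⊗ M.X) X.X).inv ≫ pr (c ⊙ₗ c' ⊙ₗ M) X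
      simp)
    (fun M => by
      ext
      change (λ_ (tensMod M X).X).hom = (tensLin (𝟙_ C) M X).hom.hom ≫ (tensMap (λₗ M).hom X).hom
      rw [← cancel_epi (𝟙_ C ◁ pr M X), reassoc_of% @pr_lin, pr_map]
      change _ = _ ≫ (λ_ M.X).hom ▷ X.X ≫ _
      simp)

theorem tensFun_map {M N : RightMod A} (X : Bimod A B) (f : M ⟶ N) : (tensFun X).F.map f = tensMap f X := rfl
theorem tensFun_μ (X : Bimod A B) (c : C) (M : RightMod A) : μₗ (tensFun X).F c M = (tensLin c M X).hom := rfl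

abbrev tensBi (X : Bimod A B) (Y : Bimod B D) : Bimod A D := X.tensorBimod Y

def prB (X : Bimod A B) (Y : Bimod B D) : X.X ⊗ Y.X ⟶ (tensBi X Y).X :=
  coequalizer.π (X.actRight ▷ Y.X) ((α_ _ _ _).hom ≫ X.X ◁ Y.actLeft)

theorem prB_cond (X : Bimod A B) (Y : Bimod B D) : X.actRight ▷ Y.X ≫ prB X Y =
    (α_ X.X B.X Y.X).hom ≫ X.X ◁ Y.actLeft ≫ prB X Y := by
  have := coequalizer.condition (X.actRight ▷ Y.X) ((α_ X.X B.X Y.X).hom ≫ X.X ◁ Y.actLeft)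
  rw [Category.assoc] at this
  exact this

instance (X : Bimod A B) (Y : Bimod B D) : Epi (prB X Y) :=
  coequalizer.π_epi
instance (X : Bimod A B) (Y : Bimod B D) (c : C) : Epi (c ◁ prB X Y) :=
  inferInstanceAs (Epi ((tensorLeft c).map (prB X Y)))
instance (X : Bimod A B) (Y : Bimod B D) (c : C) : Epi (prB X Y ▷ c) :=
  inferInstanceAs (Epi ((tensorRight c).map (prB X Y)))

theorem prB_actLeft (X : Bimod A B) (Y : Bimod B D) : A.X ◁ prB X Y ≫ (tensBi X Y).actLeft =
    (α_ _ _ _).inv ≫ X.actLeft ▷ Y.X ≫ prB X Y :=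
  Bimod.TensorBimod.whiskerLeft_π_actLeft X Y

theorem prB_actRight (X : Bimod A B) (Y : Bimod B D) : prB X Y ▷ D.X ≫ (tensBi X Y).actRight =
    (α_ _ _ _).hom ≫ X.X ◁ Y.actRight ≫ prB X Y :=
  Bimod.TensorBimod.π_tensor_id_actRight X Y

def descB (c : C) (X : Bimod A B) (Y : Bimod B D) {W : C} (h : c ⊗ X.X ⊗ Y.X ⟶ W)
    (wh : c ◁ X.actRight ▷ Y.X ≫ h =
      c ◁ (α_ X.X B.X Y.X).hom ≫ c ◁ X.X ◁ Y.actLeft ≫ h) : c ⊗ (tensBi X Y).X ⟶ W :=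
  (PreservesCoequalizer.iso (tensorLeft c) _ _).inv ≫ coequalizer.desc h (by simpa using wh)

theorem pr_descB (c : C) (X : Bimod A B) (Y : Bimod B D) {W : C} (h : c ⊗ X.X ⊗ Y.X ⟶ W)
    (wh : c ◁ X.actRight ▷ Y.X ≫ h =
      c ◁ (α_ X.X B.X Y.X).hom ≫ c ◁ X.X ◁ Y.actLeft ≫ h) :
    c ◁ prB X Y ≫ descB c X Y h wh = h :=
  id_tensor_π_preserves_coequalizer_inv_desc _ _ _ _

def assocAux (M : RightMod A) (X : Bimod A B) (Y : Bimod B D) :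
    tens M X ⊗ Y.X ⟶ tens M (tensBi X Y) :=
  descR Y.X M X ((α_ _ _ _).hom ≫ M.X ◁ prB X Y ≫ pr M (tensBi X Y)) (by
    rw [associator_naturality_left_assoc, ← whisker_exchange_assoc, pr_cond,
      associator_naturality_right_assoc, ← MonoidalCategory.whiskerLeft_comp_assoc M.X,
      prB_actLeft]
    simp)

theorem pr_assocAux (M : RightMod A) (X : Bimod A B) (Y : Bimod B D) :
    pr M X ▷ Y.X ≫ assocAux M X Y =
      (α_ _ _ _).hom ≫ M.X ◁ prB X Y ≫ pr M (tensBi X Y) :=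
  pr_descR _ _ _ _ _

def assocHom (M : RightMod A) (X : Bimod A B) (Y : Bimod B D) :
    tens (tensMod M X) Y ⟶ tens M (tensBi X Y) :=
  desc (tensMod M X) Y (assocAux M X Y) (by
    rw [← cancel_epi (pr M X ▷ B.X ▷ Y.X), ← comp_whiskerRight_assoc, pr_act,
      comp_whiskerRight_assoc, comp_whiskerRight_assoc, pr_assocAux,
      associator_naturality_left_assoc, ← whisker_exchange_assoc, pr_assocAux,
      associator_naturality_right_assoc, associator_naturality_middle_assoc,
      ← MonoidalCategory.whiskerLeft_comp_assoc, prB_cond]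
    simp)

theorem pr_assocHom (M : RightMod A) (X : Bimod A B) (Y : Bimod B D) :
    pr (tensMod M X) Y ≫ assocHom M X Y = assocAux M X Y :=
  pr_desc _ _ _ _

theorem pr_pr_assocHom (M : RightMod A) (X : Bimod A B) (Y : Bimod B D) :
    pr M X ▷ Y.X ≫ pr (tensMod M X) Y ≫ assocHom M X Y =
      (α_ _ _ _).hom ≫ M.X ◁ prB X Y ≫ pr M (tensBi X Y) := by
  rw [pr_assocHom, pr_assocAux]

theorem pr_mid (M : RightMod A) (X : Bimod A B) (Y : Bimod B D) :
    M.X ◁ X.actRight ▷ Y.X ≫ (α_ _ _ _).inv ≫ pr M X ▷ Y.X ≫ pr (tensMod M X) Y =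
      M.X ◁ (α_ X.X B.X Y.X).hom ≫ M.X ◁ X.X ◁ Y.actLeft ≫
        (α_ _ _ _).inv ≫ pr M X ▷ Y.X ≫ pr (tensMod M X) Y := by
  have h := pr_cond (tensMod M X) Y
  rw [← cancel_epi (pr M X ▷ B.X ▷ Y.X), ← comp_whiskerRight_assoc, pr_act,
    associator_naturality_left_assoc, ← whisker_exchange_assoc] at h
  rw [← cancel_epi ((α_ M.X X.X B.X).hom ▷ Y.X ≫ (α_ M.X (X.X ⊗ B.X) Y.X).hom)]
  simpa using h

def assocAuxInv (M : RightMod A) (X : Bimod A B) (Y : Bimod B D) :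
    M.X ⊗ (tensBi X Y).X ⟶ tens (tensMod M X) Y :=
  descB M.X X Y ((α_ _ _ _).inv ≫ pr M X ▷ Y.X ≫ pr (tensMod M X) Y) (pr_mid M X Y)

theorem pr_assocAuxInv (M : RightMod A) (X : Bimod A B) (Y : Bimod B D) :
    M.X ◁ prB X Y ≫ assocAuxInv M X Y =
      (α_ _ _ _).inv ≫ pr M X ▷ Y.X ≫ pr (tensMod M X) Y :=
  pr_descB _ _ _ _ _

instance (X : Bimod A B) (Y : Bimod B D) (c d : C) : Epi (c ◁ d ◁ prB X Y) :=
  inferInstanceAs (Epi ((tensorLeft c).map ((tensorLeft d).map (prB X Y))))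

def assocInv (M : RightMod A) (X : Bimod A B) (Y : Bimod B D) :
    tens M (tensBi X Y) ⟶ tens (tensMod M X) Y :=
  desc M (tensBi X Y) (assocAuxInv M X Y) (by
    rw [← cancel_epi ((M.X ⊗ A.X) ◁ prB X Y), whisker_exchange_assoc, pr_assocAuxInv,
      associator_naturality_right_assoc, ← MonoidalCategory.whiskerLeft_comp_assoc, prB_actLeft,
      MonoidalCategory.whiskerLeft_comp_assoc, MonoidalCategory.whiskerLeft_comp_assoc,
      pr_assocAuxInv, associator_inv_naturality_middle_assoc, ← comp_whiskerRight_assoc,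
      associator_inv_naturality_left_assoc, ← comp_whiskerRight_assoc, pr_cond]
    simp)

theorem pr_pr_assocInv (M : RightMod A) (X : Bimod A B) (Y : Bimod B D) :
    M.X ◁ prB X Y ≫ pr M (tensBi X Y) ≫ assocInv M X Y =
      (α_ _ _ _).inv ≫ pr M X ▷ Y.X ≫ pr (tensMod M X) Y := by
  rw [assocInv, pr_desc, pr_assocAuxInv]

def assocCIso (M : RightMod A) (X : Bimod A B) (Y : Bimod B D) :
    tens (tensMod M X) Y ≅ tens M (tensBi X Y) where
  hom := assocHom M X Y
  inv := assocInv M X Y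
  hom_inv_id := by
    rw [← cancel_epi (pr (tensMod M X) Y), ← cancel_epi (pr M X ▷ Y.X),
      reassoc_of% pr_pr_assocHom, pr_pr_assocInv]
    simp
  inv_hom_id := by
    rw [← cancel_epi (pr M (tensBi X Y)), ← cancel_epi (M.X ◁ prB X Y),
      reassoc_of% pr_pr_assocInv, pr_pr_assocHom]
    simp

def assocModIso (M : RightMod A) (X : Bimod A B) (Y : Bimod B D) :
    tensMod (tensMod M X) Y ≅ tensMod M (tensBi X Y) :=
  isoMk (assocCIso M X Y) (by
    change _ ≫ assocHom M X Y = assocHom M X Y ▷ D.X ≫ _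
    rw [← cancel_epi (pr (tensMod M X) Y ▷ D.X), reassoc_of% pr_act,
      ← cancel_epi (pr M X ▷ Y.X ▷ D.X), associator_naturality_left_assoc,
      ← whisker_exchange_assoc, pr_pr_assocHom, ← comp_whiskerRight_assoc,
      ← comp_whiskerRight_assoc, Category.assoc, pr_pr_assocHom,
      comp_whiskerRight_assoc, comp_whiskerRight_assoc, pr_act,
      associator_naturality_middle_assoc, ← MonoidalCategory.whiskerLeft_comp_assoc, prB_actRight]
    simp)

theorem pr_pr_assocMod (M : RightMod A) (X : Bimod A B) (Y : Bimod B D) :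
    pr M X ▷ Y.X ≫ pr (tensMod M X) Y ≫ (assocModIso M X Y).hom.hom =
      (α_ _ _ _).hom ≫ M.X ◁ prB X Y ≫ pr M (tensBi X Y) :=
  pr_pr_assocHom M X Y

theorem assoc_naturality {M N : RightMod A} (f : M ⟶ N) (X : Bimod A B) (Y : Bimod B D) :
    tensMap (tensMap f X) Y ≫ (assocModIso N X Y).hom =
      (assocModIso M X Y).hom ≫ tensMap f (tensBi X Y) := by
  ext
  rw [← cancel_epi (pr M X ▷ Y.X), comp_hom, comp_hom, reassoc_of% pr_map,
    reassoc_of% pr_pr_assocMod, pr_map, ← comp_whiskerRight_assoc, pr_map,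
    comp_whiskerRight_assoc, pr_pr_assocMod]
  simp [whisker_exchange_assoc]

instance (M : RightMod A) (X : Bimod A B) (c d : C) : Epi (c ◁ pr M X ▷ d) :=
  inferInstanceAs (Epi ((tensorLeft c).map ((tensorRight d).map (pr M X))))

theorem assoc_linear (c : C) (M : RightMod A) (X : Bimod A B) (Y : Bimod B D) :
    ((tensLin c (tensMod M X) Y).hom ≫ tensMap (tensLin c M X).hom Y) ≫
        (assocModIso (c ⊙ₗ M) X Y).hom =
      c ⊴ₗ (assocModIso M X Y).hom ≫ (tensLin c M (tensBi X Y)).hom := by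
  ext
  change ((tensLin c (tensMod M X) Y).hom.hom ≫ (tensMap (tensLin c M X).hom Y).hom) ≫
        (assocModIso (c ⊙ₗ M) X Y).hom.hom =
      c ◁ (assocModIso M X Y).hom.hom ≫ (tensLin c M (tensBi X Y)).hom.hom
  rw [← cancel_epi (c ◁ pr (tensMod M X) Y), Category.assoc, reassoc_of% pr_lin,
    reassoc_of% pr_map, ← cancel_epi (c ◁ pr M X ▷ Y.X),
    ← MonoidalCategory.whiskerLeft_comp_assoc,
    ← MonoidalCategory.whiskerLeft_comp_assoc, Category.assoc, pr_pr_assocMod,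
    MonoidalCategory.whiskerLeft_comp_assoc, MonoidalCategory.whiskerLeft_comp_assoc, pr_lin,
    associator_inv_naturality_middle_assoc, ← comp_whiskerRight_assoc, pr_lin,
    comp_whiskerRight_assoc, pr_pr_assocMod]
  change _ ≫ _ ≫ (α_ (c ⊗ M.X) X.X Y.X).hom ≫ (c ⊗ M.X) ◁ prB X Y ≫ _ = _
  simp

/-- The canonical isomorphism `(- ⊗_A X) ⊗_B Y ≅ - ⊗_A (X ⊗_B Y)` of module functors. -/
def assocIso (X : Bimod A B) (Y : Bimod B D) :
    (tensFun X).comp (tensFun Y) ≅ tensFun (tensBi X Y) :=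
  ModFun.isoMk (NatIso.ofComponents (fun M => assocModIso M X Y)
    (fun f => assoc_naturality f X Y)) (fun c M => by
      rw [ModFun.comp_μ]
      exact assoc_linear c M X Y)
end
end RightMod

namespace CenterLin
section
variable {C : Type u} [Category.{v} C] [MonoidalCategory C] [Preadditive C] [MonoidalPreadditive C]

instance (Z W : Center C) : Add (Z ⟶ W) :=
  ⟨fun f g => ⟨f.f + g.f, fun U => by simp [MonoidalPreadditive.add_whiskerRight]⟩⟩
instance (Z W : Center C) : Zero (Z ⟶ W) := ⟨⟨0, fun U => by simp⟩⟩
instance (Z W : Center C) : Neg (Z ⟶ W) :=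
  ⟨fun f => ⟨-f.f, fun U => by
    have h : (-f.f) ▷ U = -(f.f ▷ U) := (tensorRight U).map_neg
    have h' : U ◁ (-f.f) = -(U ◁ f.f) := (tensorLeft U).map_neg
    simp [h, h']⟩⟩

theorem add_f {Z W : Center C} (f g : Z ⟶ W) : (f + g).f = f.f + g.f := rfl
theorem zero_f (Z W : Center C) : (0 : Z ⟶ W).f = 0 := rfl
theorem neg_f {Z W : Center C} (f : Z ⟶ W) : (-f).f = -f.f := rfl

instance (Z W : Center C) : AddCommGroup (Z ⟶ W) where
  add_assoc f g h := Center.ext _ _ (add_assoc f.f g.f h.f)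
  zero_add f := Center.ext _ _ (zero_add f.f)
  add_zero f := Center.ext _ _ (add_zero f.f)
  nsmul := nsmulRec
  zsmul := zsmulRec
  neg_add_cancel f := Center.ext _ _ (neg_add_cancel f.f)
  add_comm f g := Center.ext _ _ (add_comm f.f g.f)

instance : Preadditive (Center C) where
  homGroup := inferInstance
  add_comp _ _ _ f g h := Center.ext _ _ (Preadditive.add_comp _ _ _ f.f g.f h.f)
  comp_add _ _ _ f g h := Center.ext _ _ (Preadditive.comp_add _ _ _ f.f g.f h.f)

def fHom (Z W : Center C) : (Z ⟶ W) →+ (Z.1 ⟶ W.1) where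
  toFun f := f.f
  map_zero' := rfl
  map_add' _ _ := rfl

theorem sum_f {Z W : Center C} {ι : Type*} (s : Finset ι) (f : ι → (Z ⟶ W)) :
    (∑ i ∈ s, f i).f = ∑ i ∈ s, (f i).f := map_sum (fHom Z W) f s

variable (k : Type w) [Field k] [Linear k C] [MonoidalLinear k C]

instance (Z W : Center C) : SMul k (Z ⟶ W) :=
  ⟨fun c f => ⟨c • f.f, fun U => by simp⟩⟩

theorem smul_f {Z W : Center C} (c : k) (f : Z ⟶ W) : (c • f).f = c • f.f := rfl

instance : Linear k (Center C) where
  homModule _ _ :=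
    { one_smul f := Center.ext _ _ (one_smul k f.f)
      mul_smul a b f := Center.ext _ _ (mul_smul a b f.f)
      smul_zero a := Center.ext _ _ (smul_zero a)
      smul_add a f g := Center.ext _ _ (smul_add a f.f g.f)
      add_smul a b f := Center.ext _ _ (add_smul a b f.f)
      zero_smul f := Center.ext _ _ (zero_smul k f.f) }
  smul_comp _ _ _ a f g := Center.ext _ _ (Linear.smul_comp _ _ _ a f.f g.f)
  comp_smul _ _ _ f a g := Center.ext _ _ (Linear.comp_smul _ _ _ f.f a g.f)
end

section
variable {C : Type u} [Category.{v} C] [MonoidalCategory C] [Preadditive C] [MonoidalPreadditive C]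
  [HasFiniteBiproducts C] {J : Type} [Finite J]

def sumβ (X : J → C) (b : ∀ j, HalfBraiding (X j)) (U : C) : (⨁ X) ⊗ U ≅ U ⊗ (⨁ X) :=
  rightDistributor X U ≪≫ biproduct.mapIso (fun j => (b j).β U) ≪≫ (leftDistributor U X).symm

theorem ι_sumβ (X : J → C) (b : ∀ j, HalfBraiding (X j)) (U : C) (j : J) :
    biproduct.ι X j ▷ U ≫ (sumβ X b U).hom = ((b j).β U).hom ≫ U ◁ biproduct.ι X j := by
  simp [sumβ]

theorem sumβ_π (X : J → C) (b : ∀ j, HalfBraiding (X j)) (U : C) (j : J) :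
    (sumβ X b U).hom ≫ U ◁ biproduct.π X j = biproduct.π X j ▷ U ≫ ((b j).β U).hom := by
  simp [sumβ]

/-- The half-braiding on a finite direct sum. -/
def sumHalf (X : J → C) (b : ∀ j, HalfBraiding (X j)) : HalfBraiding (⨁ X) where
  β := sumβ X b
  monoidal U V := by
    apply rightDistributor_ext_left
    intro j
    rw [ι_sumβ, HalfBraiding.monoidal]
    have h1 : biproduct.ι X j ▷ (U ⊗ V) ≫ (α_ _ _ _).inv =
      (α_ _ _ _).inv ≫ biproduct.ι X j ▷ U ▷ V := by simp
    rw [reassoc_of% h1, ← comp_whiskerRight_assoc, ι_sumβ, comp_whiskerRight_assoc,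
      associator_naturality_middle_assoc, ← MonoidalCategory.whiskerLeft_comp_assoc, ι_sumβ]
    simp
  naturality {U V} f := by
    apply rightDistributor_ext_left
    intro j
    rw [← whisker_exchange_assoc, ι_sumβ, reassoc_of% (ι_sumβ X b U j),
      HalfBraiding.naturality_assoc, whisker_exchange]

def sumObj (Z : J → Center C) : Center C := ⟨⨁ fun j => (Z j).1, sumHalf _ fun j => (Z j).2⟩

def sumι (Z : J → Center C) (j : J) : Z j ⟶ sumObj Z :=
  ⟨biproduct.ι (fun j => (Z j).1) j, fun U =>
    ι_sumβ (fun j => (Z j).1) (fun j => (Z j).2) U j⟩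

def sumπ (Z : J → Center C) (j : J) : sumObj Z ⟶ Z j :=
  ⟨biproduct.π (fun j => (Z j).1) j, fun U =>
    (sumβ_π (fun j => (Z j).1) (fun j => (Z j).2) U j).symm⟩

theorem sum_total [Fintype J] (Z : J → Center C) :
    ∑ j, sumπ Z j ≫ sumι Z j = 𝟙 (sumObj Z) := by
  apply Center.ext
  rw [sum_f]
  exact biproduct.total (f := fun j => (Z j).1)

theorem sumι_π_self (Z : J → Center C) (j : J) : sumι Z j ≫ sumπ Z j = 𝟙 (Z j) :=
  Center.ext _ _ (biproduct.ι_π_self (fun j => (Z j).1) j)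

theorem sumι_π_ne (Z : J → Center C) {i j : J} (h : i ≠ j) : sumι Z i ≫ sumπ Z j = 0 :=
  Center.ext _ _ (biproduct.ι_π_ne (fun j => (Z j).1) h)

def sumBicone (Z : J → Center C) : Bicone Z := by
  classical
  exact
  { pt := sumObj Z
    π := sumπ Z
    ι := sumι Z
    ι_π := fun i j => by
      by_cases h : i = j
      · subst h; simpa using sumι_π_self Z i
      · simpa [h] using sumι_π_ne Z h }

end

instance {C : Type u} [Category.{v} C] [MonoidalCategory C] [Preadditive C]
    [MonoidalPreadditive C] [HasFiniteBiproducts C] : HasFiniteBiproducts (Center C) where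
  out n :=
    { has_biproduct := fun Z => HasBiproduct.mk
        { bicone := sumBicone Z
          isBilimit := isBilimitOfTotal _ (sum_total Z) } }
end CenterLin

/-- The tensor product over `k` of two `k`-linear categories: objects are pairs of objects, and
morphism spaces are tensor products of morphism spaces. -/
structure TensorCat (k : Type w) [Field k] (C : Type u) [Category.{v} C] [Preadditive C] [Linear k C]
    (D : Type u₁) [Category.{v₁} D] [Preadditive D] [Linear k D] : Type (max u v u₁ v₁) where
  fst : C
  snd : D

namespace TensorCat
open scoped TensorProduct
section
variable {k : Type w} [Field k] {C : Type u} [Category.{v} C] [Preadditive C] [Linear k C]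
    {D : Type u₁} [Category.{v₁} D] [Preadditive D] [Linear k D]

def compMap (a b c : TensorCat k C D) :
    ((a.fst ⟶ b.fst) ⊗[k] (a.snd ⟶ b.snd)) →ₗ[k] ((b.fst ⟶ c.fst) ⊗[k] (b.snd ⟶ c.snd)) →ₗ[k]
      ((a.fst ⟶ c.fst) ⊗[k] (a.snd ⟶ c.snd)) :=
  TensorProduct.map₂ (Linear.comp a.fst b.fst c.fst) (Linear.comp a.snd b.snd c.snd)

instance : Category (TensorCat k C D) where
  Hom a b := (a.fst ⟶ b.fst) ⊗[k] (a.snd ⟶ b.snd)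
  id a := 𝟙 a.fst ⊗ₜ 𝟙 a.snd
  comp {a b c} s t := compMap a b c s t
  id_comp {a b} t := by
    refine TensorProduct.induction_on t ?_ ?_ ?_
    · simp
    · intro f g; simp [compMap]
    · intro s t hs ht; rw [map_add, hs, ht]
  comp_id {a b} t := by
    refine TensorProduct.induction_on t ?_ ?_ ?_
    · simp
    · intro f g; simp [compMap]
    · intro s t hs ht; rw [map_add, LinearMap.add_apply, hs, ht]
  assoc {a b c d} r s t := by
    refine TensorProduct.induction_on r (by simp) ?_ ?_
    · intro f g
      refine TensorProduct.induction_on s (by simp) ?_ ?_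
      · intro f' g'
        refine TensorProduct.induction_on t (by simp) ?_ ?_
        · intro f'' g''; simp [compMap]
        · intro x y hx hy
          simp only [map_add, hx, hy]
      · intro x y hx hy
        simp only [map_add, LinearMap.add_apply, hx, hy]
    · intro x y hx hy
      simp only [map_add, LinearMap.add_apply, hx, hy]

instance : Preadditive (TensorCat k C D) where
  homGroup a b := inferInstanceAs (AddCommGroup ((a.fst ⟶ b.fst) ⊗[k] (a.snd ⟶ b.snd)))
  add_comp a b c r s t := by
    have h : ∀ r s : (a.fst ⟶ b.fst) ⊗[k] (a.snd ⟶ b.snd),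
        compMap a b c (r + s) t = compMap a b c r t + compMap a b c s t := by
      intro r s
      rw [map_add, LinearMap.add_apply]
    exact h r s
  comp_add a b c r s t := by
    have h : ∀ s t : (b.fst ⟶ c.fst) ⊗[k] (b.snd ⟶ c.snd),
        compMap a b c r (s + t) = compMap a b c r s + compMap a b c r t := by
      intro s t
      rw [map_add]
    exact h s t

end

section
variable (k : Type w) [Field k] (C : Type u) [Category.{v} C] [Preadditive C] [Linear k C]
  [MonoidalCategory C] [MonoidalPreadditive C] [MonoidalLinear k C] [BraidedCategory C]

/-- The object `a ⊗ b` of the Drinfeld center, with half-braiding given on `a` by the reverse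
(inverse) braiding and on `b` by the braiding. -/
def gcObj (a b : C) : Center C :=
  @Center.ofBraidedObj C _ _ (reverseBraiding C) a ⊗ Center.ofBraidedObj b

def gcPure {a b a' b' : C} (f : a ⟶ a') (g : b ⟶ b') : gcObj C a b ⟶ gcObj C a' b' :=
  (@Center.ofBraided C _ _ (reverseBraiding C)).map f ⊗ₘ (Center.ofBraided C).map g

theorem gcPure_f {a b a' b' : C} (f : a ⟶ a') (g : b ⟶ b') : (gcPure C f g).f = f ⊗ₘ g := rfl

def gcMap (a b a' b' : C) :
    ((a ⟶ a') ⊗[k] (b ⟶ b')) →ₗ[k] (gcObj C a b ⟶ gcObj C a' b') :=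
  TensorProduct.lift (LinearMap.mk₂ k (fun f g => gcPure C f g)
    (fun f f' g => Center.ext _ _ (MonoidalPreadditive.add_tensor f f' g))
    (fun c f g => Center.ext _ _ (by
      change (c • f) ⊗ₘ g = c • (f ⊗ₘ g)
      simp [MonoidalCategory.tensorHom_def]))
    (fun f g g' => Center.ext _ _ (MonoidalPreadditive.tensor_add f g g'))
    (fun c f g => Center.ext _ _ (by
      change f ⊗ₘ (c • g) = c • (f ⊗ₘ g)
      simp [MonoidalCategory.tensorHom_def])))

theorem gcMap_tmul {a b a' b' : C} (f : a ⟶ a') (g : b ⟶ b') :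
    gcMap k C a b a' b' (f ⊗ₜ g) = gcPure C f g := rfl

theorem gcMap_comp (a b c : TensorCat k C C) (s : (a.fst ⟶ b.fst) ⊗[k] (a.snd ⟶ b.snd))
    (t : (b.fst ⟶ c.fst) ⊗[k] (b.snd ⟶ c.snd)) :
    gcMap k C _ _ _ _ (compMap a b c s t) = gcMap k C _ _ _ _ s ≫ gcMap k C _ _ _ _ t := by
  refine TensorProduct.induction_on s (by simp) ?_ ?_
  · intro f g
    refine TensorProduct.induction_on t (by simp) ?_ ?_
    · intro f' g'
      apply Center.ext
      change (f ≫ f') ⊗ₘ (g ≫ g') = (f ⊗ₘ g) ≫ (f' ⊗ₘ g')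
      simp
    · intro x y hx hy
      simp only [map_add, hx, hy, Preadditive.comp_add]
  · intro x y hx hy
    simp only [map_add, LinearMap.add_apply, hx, hy, Preadditive.add_comp]

/-- The functor `(a, b) ↦ a ⊗ b` to the Drinfeld center. -/
def gcPre : TensorCat k C C ⥤ Center C where
  obj a := gcObj C a.fst a.snd
  map {a b} t := gcMap k C a.fst a.snd b.fst b.snd t
  map_id a := Center.ext _ _ (MonoidalCategory.id_tensorHom_id a.fst a.snd)
  map_comp {a b c} s t := gcMap_comp k C a b c s t

instance : (gcPre k C).Additive where
  map_add {a b} s t := map_add (gcMap k C a.fst a.snd b.fst b.snd) s t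

end
end TensorCat

/-- The Deligne product of finitely semisimple categories over an algebraically closed field,
obtained from the tensor product of linear categories by adjoining finite direct sums (which for
such categories already gives a semisimple abelian category, with simple objects the pairs of
simple objects). -/
abbrev DeligneProd (k : Type w) [Field k] (C : Type u) [Category.{v} C] [Preadditive C] [Linear k C]
    (D : Type u₁) [Category.{v₁} D] [Preadditive D] [Linear k D] :=
  Mat_ (TensorCat k C D)

/-- The canonical functor from the Deligne product of `C` with reversed braiding and `C` to the
Drinfeld center of `C`. -/
def functorGC (k : Type w) [Field k] (C : Type u) [Category.{v} C] [Preadditive C] [Linear k C]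
    [HasFiniteBiproducts C] [MonoidalCategory C] [MonoidalPreadditive C] [MonoidalLinear k C]
    [BraidedCategory C] : DeligneProd k C C ⥤ Center C :=
  Mat_.lift (TensorCat.gcPre k C)

/-- Fusion categories: `k`-linear rigid monoidal categories with simple unit and
finite-dimensional morphism spaces that are finitely semisimple, i.e. there are finitely many
simple objects up to isomorphism and each object is a finite direct sum of simple objects. -/
class FusionCategory (k : Type w) [Field k] (C : Type u) [Category.{v} C] [MonoidalCategory C]
    [Abelian C] [Linear k C] [MonoidalPreadditive C] [MonoidalLinear k C] [RigidCategory C] :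
    Prop where
  simple_unit : Simple (𝟙_ C)
  finite_hom (X Y : C) : FiniteDimensional k (X ⟶ Y)
  finite_simples : ∃ (n : ℕ) (S : Fin n → C), (∀ i, Simple (S i)) ∧
    (∀ i j, Nonempty (S i ≅ S j) → i = j) ∧ ∀ X : C, Simple X → ∃ i, Nonempty (X ≅ S i)
  semisimple (X : C) : ∃ (n : ℕ) (S : Fin n → C), (∀ i, Simple (S i)) ∧ Nonempty (X ≅ ⨁ S)

attribute [instance] FusionCategory.finite_hom

/-- The braiding is modular if the canonical functor from the Deligne product of the reverse of
`C` with `C` to the Drinfeld center is an equivalence. -/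
class ModularBraiding (k : Type w) [Field k] (C : Type u) [Category.{v} C] [MonoidalCategory C]
    [Abelian C] [Linear k C] [MonoidalPreadditive C] [MonoidalLinear k C] [BraidedCategory C] :
    Prop where
  isEquivalence : (functorGC k C).IsEquivalence

namespace CenterRep
open TensorCat CenterLin
section
variable {k : Type w} [Field k] {C : Type u} [Category.{v} C] [MonoidalCategory C]
    [Abelian C] [Linear k C] [MonoidalPreadditive C] [MonoidalLinear k C]

theorem hom_zero_or_smul [IsAlgClosed k] [∀ X Y : C, FiniteDimensional k (X ⟶ Y)] {n : ℕ}
    {S : Fin n → C} (hS : ∀ i, Simple (S i))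
    (hne : ∀ i j, Nonempty (S i ≅ S j) → i = j) {i j : Fin n} (h : i ≠ j) (f : S i ⟶ S j) :
    f = 0 := by
  have := hS i
  have := hS j
  by_contra h0
  have := isIso_of_hom_simple h0
  exact h (hne i j ⟨asIso f⟩)

variable [BraidedCategory C]

theorem gc_full [ModularBraiding k C] : (gcPre k C).Full := by
  have := ModularBraiding.isEquivalence (k := k) (C := C)
  have : (Mat_.lift (gcPre k C)).Full :=
    (inferInstance : (functorGC k C).Full)
  exact Functor.Full.of_iso (Mat_.embeddingLiftIso (gcPre k C))

theorem gc_hom_ne [IsAlgClosed k] [∀ X Y : C, FiniteDimensional k (X ⟶ Y)] [ModularBraiding k C]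
    {n : ℕ} {S : Fin n → C} (hS : ∀ i, Simple (S i))
    (hne : ∀ i j, Nonempty (S i ≅ S j) → i = j) {s t : Fin n × Fin n} (h : s ≠ t)
    (f : gcObj C (S s.1) (S s.2) ⟶ gcObj C (S t.1) (S t.2)) : f = 0 := by
  have := gc_full (k := k) (C := C)
  obtain ⟨r, rfl⟩ := (gcPre k C).map_surjective (X := TensorCat.mk (S s.1) (S s.2))
    (Y := TensorCat.mk (S t.1) (S t.2)) f
  change gcMap k C _ _ _ _ r = 0
  refine TensorProduct.induction_on r (map_zero _) ?_ ?_
  · intro f g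
    have : f = 0 ∨ g = 0 := by
      by_cases h1 : s.1 = t.1
      · right
        exact hom_zero_or_smul (k := k) hS hne (fun h2 => h (Prod.ext h1 h2)) g
      · left
        exact hom_zero_or_smul (k := k) hS hne h1 f
    rcases this with rfl | rfl <;> simp
  · intro x y hx hy
    rw [map_add, hx, hy, add_zero]

theorem gc_hom_self [IsAlgClosed k] [∀ X Y : C, FiniteDimensional k (X ⟶ Y)] [ModularBraiding k C]
    {X Y : C} [Simple X] [Simple Y] (f : gcObj C X Y ⟶ gcObj C X Y) : ∃ c : k, f = c • 𝟙 _ := by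
  have := gc_full (k := k) (C := C)
  obtain ⟨r, rfl⟩ := (gcPre k C).map_surjective (X := TensorCat.mk X Y)
    (Y := TensorCat.mk X Y) f
  change ∃ c : k, gcMap k C _ _ _ _ r = c • 𝟙 _
  refine TensorProduct.induction_on r ⟨0, by simp⟩ ?_ ?_
  · intro f g
    obtain ⟨a, rfl⟩ := endomorphism_simple_eq_smul_id k f
    obtain ⟨b, rfl⟩ := endomorphism_simple_eq_smul_id k g
    refine ⟨a * b, ?_⟩
    rw [TensorProduct.smul_tmul_smul, map_smul, gcMap_tmul]
    congr 1
    exact Center.ext _ _ (MonoidalCategory.id_tensorHom_id X Y)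
  · rintro x y ⟨a, hx⟩ ⟨b, hy⟩
    exact ⟨a + b, by rw [map_add, hx, hy, add_smul]⟩

variable {X Y : C}

/-- The property that `u` represents `P` at the object `Z`. -/
def Good (D : Center C) (u : D.1 ⊗ X ⟶ Y) (P : ∀ Z : Center C, Submodule k (Z.1 ⊗ X ⟶ Y))
    (Z : Center C) : Prop :=
  (∀ f : Z ⟶ D, f.f ▷ X ≫ u = 0 → f = 0) ∧ ∀ h ∈ P Z, ∃ f : Z ⟶ D, f.f ▷ X ≫ u = h

theorem good_of_retract (D : Center C) (u : D.1 ⊗ X ⟶ Y)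
    (P : ∀ Z : Center C, Submodule k (Z.1 ⊗ X ⟶ Y))
    (hP : ∀ {Z W : Center C} (f : Z ⟶ W) (h : W.1 ⊗ X ⟶ Y), h ∈ P W → f.f ▷ X ≫ h ∈ P Z)
    (Z : Center C) {T : Type*} [Fintype T] (s : T → Center C) (p : ∀ t, Z ⟶ s t)
    (q : ∀ t, s t ⟶ Z) (hpq : ∑ t, p t ≫ q t = 𝟙 Z) (hs : ∀ t, Good D u P (s t)) :
    Good D u P Z := by
  have key : ∀ h : Z.1 ⊗ X ⟶ Y, ∑ t, (p t).f ▷ X ≫ (q t).f ▷ X ≫ h = h := by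
    intro h
    have := congrArg (fun g => Center.Hom.f g ▷ X ≫ h) hpq
    simp only [sum_f, sum_whiskerRight, Preadditive.sum_comp] at this
    simpa using this
  constructor
  · intro f hf
    have : ∀ t, q t ≫ f = 0 := fun t => (hs t).1 _ (by
      rw [Center.comp_f, comp_whiskerRight, Category.assoc, hf, comp_zero])
    rw [← Category.id_comp f, ← hpq, Preadditive.sum_comp]
    exact Finset.sum_eq_zero fun t _ => by rw [Category.assoc, this, comp_zero]
  · intro h hh
    choose g hg using fun t => (hs t).2 _ (hP (q t) h hh)
    refine ⟨∑ t, p t ≫ g t, ?_⟩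
    rw [sum_f, sum_whiskerRight, Preadditive.sum_comp]
    rw [← key h]
    refine Finset.sum_congr rfl fun t _ => ?_
    rw [Center.comp_f, comp_whiskerRight, Category.assoc, hg]

theorem exists_decomp [RigidCategory C] [FusionCategory k C] {n : ℕ} {S : Fin n → C}
    (hall : ∀ X : C, Simple X → ∃ i, Nonempty (X ≅ S i)) (Z : C) :
    ∃ (m : ℕ) (r : Fin m → Fin n) (p : ∀ l, Z ⟶ S (r l)) (q : ∀ l, S (r l) ⟶ Z),
      ∑ l, p l ≫ q l = 𝟙 Z := by
  obtain ⟨m, s, hs, ⟨e⟩⟩ := FusionCategory.semisimple k Z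
  choose r hr using fun l => hall (s l) (hs l)
  refine ⟨m, r, fun l => e.hom ≫ biproduct.π s l ≫ (hr l).some.hom,
    fun l => (hr l).some.inv ≫ biproduct.ι s l ≫ e.inv, ?_⟩
  have h := biproduct.total (f := s)
  have h2 : e.hom ≫ (∑ l, biproduct.π s l ≫ biproduct.ι s l) ≫ e.inv = 𝟙 Z := by
    rw [h]; simp
  rw [← h2]
  rw [Preadditive.sum_comp, Preadditive.comp_sum]
  simp

theorem exists_rep [IsAlgClosed k] [RigidCategory C] [FusionCategory k C] [ModularBraiding k C]
    (P : ∀ Z : Center C, Submodule k (Z.1 ⊗ X ⟶ Y))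
    (hP : ∀ {Z W : Center C} (f : Z ⟶ W) (h : W.1 ⊗ X ⟶ Y), h ∈ P W → f.f ▷ X ≫ h ∈ P Z) :
    ∃ (D : Center C) (u : D.1 ⊗ X ⟶ Y), u ∈ P D ∧ ∀ Z, Good D u P Z := by
  obtain ⟨n, S, hS, hne, hall⟩ := FusionCategory.finite_simples (k := k) (C := C)
  let s : Fin n × Fin n → Center C := fun t => gcObj C (S t.1) (S t.2)
  let b := fun t => Module.finBasis k (P (s t))
  let J := Σ t : Fin n × Fin n, Fin (Module.finrank k (P (s t)))
  let Zs : J → Center C := fun x => s x.1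
  let e : ∀ x : J, (Zs x).1 ⊗ X ⟶ Y := fun x => (b x.1 x.2 : _)
  have he : ∀ x, e x ∈ P (Zs x) := fun x => (b x.1 x.2).2
  let u : (sumObj Zs).1 ⊗ X ⟶ Y := ∑ x, (sumπ Zs x).f ▷ X ≫ e x
  have hu : ∀ x, (sumι Zs x).f ▷ X ≫ u = e x := by
    intro x
    simp only [u, Preadditive.comp_sum]
    rw [Finset.sum_eq_single x]
    · rw [← comp_whiskerRight_assoc, ← Center.comp_f, sumι_π_self]; simp
    · intro y _ hy
      rw [← comp_whiskerRight_assoc, ← Center.comp_f, sumι_π_ne _ hy.symm, zero_f]; simp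
    · simp
  refine ⟨sumObj Zs, u, Submodule.sum_mem _ fun x _ => hP _ _ (he x), ?_⟩
  have hgood : ∀ t, Good (sumObj Zs) u P (s t) := by
    intro t
    constructor
    · intro f hf
      have h0 : ∀ x : J, x.1 ≠ t → f ≫ sumπ Zs x = 0 := fun x hx =>
        gc_hom_ne (k := k) hS hne (Ne.symm hx) _
      have h1 : ∀ m, ∃ c : k, f ≫ sumπ Zs ⟨t, m⟩ = c • 𝟙 _ := fun m => by
        have := hS t.1
        have := hS t.2
        exact gc_hom_self _
      choose c hc using h1
      have h2 : f.f ▷ X ≫ u = ∑ m, c m • (b t m : (s t).1 ⊗ X ⟶ Y) := by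
        simp only [u, Preadditive.comp_sum]
        rw [Fintype.sum_sigma, Finset.sum_eq_single t]
        · refine Finset.sum_congr rfl fun m _ => ?_
          rw [← comp_whiskerRight_assoc, ← Center.comp_f, hc, smul_f]
          simp [e]
        · intro t' _ ht'
          refine Finset.sum_eq_zero fun m _ => ?_
          rw [← comp_whiskerRight_assoc, ← Center.comp_f, h0 ⟨t', m⟩ ht', zero_f]
          simp
        · simp
      rw [h2] at hf
      have h3 : ∑ m, c m • b t m = 0 := by
        apply Subtype.ext
        simpa using hf
      have h4 := Fintype.linearIndependent_iff.1 (b t).linearIndependent c h3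
      have h5 : ∀ x, f ≫ sumπ Zs x = 0 := by
        rintro ⟨t', m⟩
        by_cases h : t' = t
        · subst h
          rw [hc, h4, zero_smul]
        · exact h0 _ h
      rw [← Category.comp_id f, ← sum_total Zs, Preadditive.comp_sum]
      exact Finset.sum_eq_zero fun x _ => by rw [← Category.assoc, h5, zero_comp]
    · intro h hh
      refine ⟨∑ m, (b t).repr ⟨h, hh⟩ m • sumι Zs ⟨t, m⟩, ?_⟩
      have h1 := congrArg (fun x : P (s t) => (x : (s t).1 ⊗ X ⟶ Y)) ((b t).sum_repr ⟨h, hh⟩)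
      simp only [Submodule.coe_sum, Submodule.coe_smul] at h1
      conv_rhs => rw [← h1]
      rw [sum_f, sum_whiskerRight, Preadditive.sum_comp]
      refine Finset.sum_congr rfl fun m _ => ?_
      rw [smul_f, MonoidalLinear.smul_whiskerRight, Linear.smul_comp, hu]
  have hgc : ∀ A B : C, Good (sumObj Zs) u P (gcObj C A B) := by
    intro A B
    obtain ⟨m, r, p, q, hpq⟩ := exists_decomp (k := k) hall A
    obtain ⟨m', r', p', q', hpq'⟩ := exists_decomp (k := k) hall B
    refine good_of_retract _ u P hP _ (T := Fin m × Fin m') (fun t => s (r t.1, r' t.2))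
      (fun t => gcPure C (p t.1) (p' t.2)) (fun t => gcPure C (q t.1) (q' t.2)) ?_
      (fun t => hgood _)
    apply Center.ext
    rw [sum_f]
    change ∑ t : Fin m × Fin m', (p t.1 ⊗ₘ p' t.2) ≫ (q t.1 ⊗ₘ q' t.2) = 𝟙 (A ⊗ B)
    rw [← MonoidalCategory.id_tensorHom_id, ← hpq, ← hpq', sum_tensor, Fintype.sum_prod_type]
    refine Finset.sum_congr rfl fun l _ => ?_
    rw [tensor_sum]
    simp
  intro Z
  have := ModularBraiding.isEquivalence (k := k) (C := C)
  let M := (functorGC k C).objPreimage Z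
  let i : (functorGC k C).obj M ≅ Z := (functorGC k C).objObjPreimageIso Z
  have hM : Good (sumObj Zs) u P ((functorGC k C).obj M) :=
    good_of_retract _ u P hP _ (fun l => gcObj C (M.X l).fst (M.X l).snd)
      (fun l => biproduct.π (fun l => (gcPre k C).obj (M.X l)) l)
      (fun l => biproduct.ι (fun l => (gcPre k C).obj (M.X l)) l)
      biproduct.total (fun l => hgc _ _)
  exact good_of_retract _ u P hP _ (T := Unit) (fun _ => (functorGC k C).obj M) (fun _ => i.inv)
    (fun _ => i.hom) (by simp) (fun _ => hM)
end
end CenterRep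

namespace ModHom
open CenterRep CenterLin
section
variable {k : Type w} [Field k] {C : Type u} [Category.{v} C] [MonoidalCategory C]
    [Abelian C] [Linear k C] [MonoidalPreadditive C] [MonoidalLinear k C] [RigidCategory C]
    {A B : Mon C}

/-- The regular right module. -/
def regMod (A : Mon C) : RightMod A where
  X := A.X
  act := MonObj.mul
  act_one := MonObj.mul_one A.X
  act_mul := by rw [MonObj.mul_assoc]; simp

def homMk {F G : ModFun C (RightMod A) (RightMod B)} (h : ∀ M, (F.F.obj M).X ⟶ (G.F.obj M).X)
    (h1 : ∀ M, (F.F.obj M).act ≫ h M = h M ▷ B.X ≫ (G.F.obj M).act)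
    (h2 : ∀ {M N : RightMod A} (f : M ⟶ N), (F.F.map f).hom ≫ h N = h M ≫ (G.F.map f).hom)
    (h3 : ∀ (c : C) (M : RightMod A), (μₗ F.F c M).hom ≫ h (c ⊙ₗ M) =
      c ◁ h M ≫ (μₗ G.F c M).hom) : F ⟶ G where
  τ := { app M := ⟨h M, h1 M⟩
         naturality _ _ f := RightMod.hom_ext _ _ (h2 f) }
  comm c M := RightMod.hom_ext _ _ (h3 c M)

theorem hom_nat {F G : ModFun C (RightMod A) (RightMod B)} (φ : F ⟶ G) {M N : RightMod A}
    (f : M ⟶ N) : (F.F.map f).hom ≫ (φ.τ.app N).hom = (φ.τ.app M).hom ≫ (G.F.map f).hom :=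
  congrArg RightMod.Hom.hom (φ.τ.naturality f)

theorem hom_comm {F G : ModFun C (RightMod A) (RightMod B)} (φ : F ⟶ G) (c : C) (M : RightMod A) :
    (μₗ F.F c M).hom ≫ (φ.τ.app (c ⊙ₗ M)).hom = c ◁ (φ.τ.app M).hom ≫ (μₗ G.F c M).hom :=
  congrArg RightMod.Hom.hom (φ.comm c M)

variable (k) in
def homSub (F G : ModFun C (RightMod A) (RightMod B)) (M : RightMod A) :
    Submodule k ((F.F.obj M).X ⟶ (G.F.obj M).X) where
  carrier := {h | ∃ φ : F ⟶ G, (φ.τ.app M).hom = h}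
  zero_mem' := ⟨homMk (fun _ => 0) (by simp) (by simp) (by simp), rfl⟩
  add_mem' := by
    rintro _ _ ⟨φ, rfl⟩ ⟨ψ, rfl⟩
    exact ⟨homMk (fun M => (φ.τ.app M).hom + (ψ.τ.app M).hom)
      (fun M => by simp [RightMod.Hom.comm, MonoidalPreadditive.add_whiskerRight])
      (fun f => by simp [hom_nat])
      (fun c M => by simp [hom_comm, MonoidalPreadditive.whiskerLeft_add]), rfl⟩
  smul_mem' := by
    rintro a _ ⟨φ, rfl⟩
    exact ⟨homMk (fun M => a • (φ.τ.app M).hom)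
      (fun M => by simp [RightMod.Hom.comm])
      (fun f => by simp [hom_nat])
      (fun c M => by simp [hom_comm]), rfl⟩

def actHom (M : RightMod A) : M.X ⊙ₗ regMod A ⟶ M where
  hom := M.act
  comm := by
    change ((α_ _ _ _).hom ≫ M.X ◁ MonObj.mul) ≫ M.act = M.act ▷ A.X ≫ M.act
    rw [Category.assoc, M.act_mul]
    simp

instance (M : RightMod A) : IsSplitEpi M.act :=
  ⟨⟨⟨(ρ_ _).inv ≫ M.X ◁ MonObj.one, by rw [Category.assoc, M.act_one]; simp⟩⟩⟩

theorem epi_act (c : C) (M : RightMod A) (X : Bimod A B) :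
    Epi (c ◁ (RightMod.tensMap (actHom M) X).hom) := by
  have h := RightMod.pr_map (actHom M) X
  have h1 : Epi ((actHom M).hom ▷ X.X ≫ RightMod.pr M X) := by
    have : Epi ((actHom M).hom ▷ X.X) := inferInstanceAs (Epi ((tensorRight X.X).map M.act))
    exact epi_comp _ _
  rw [← h] at h1
  have := epi_of_epi (RightMod.pr (M.X ⊙ₗ regMod A) X) (RightMod.tensMap (actHom M) X).hom
  exact inferInstanceAs (Epi ((tensorLeft c).map (RightMod.tensMap (actHom M) X).hom))

theorem hom_ext_reg (X : Bimod A B) (Z : Center C) (G : ModFun C (RightMod A) (RightMod B))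
    (φ ψ : Z ⊙ₗ RightMod.tensFun X ⟶ G)
    (h : (φ.τ.app (regMod A)).hom = (ψ.τ.app (regMod A)).hom) : φ = ψ := by
  ext M
  have h1 : (φ.τ.app (M.X ⊙ₗ regMod A)).hom = (ψ.τ.app (M.X ⊙ₗ regMod A)).hom := by
    have a := hom_comm φ M.X (regMod A)
    have b := hom_comm ψ M.X (regMod A)
    rw [h, ← b] at a
    have : IsIso (μₗ (Z ⊙ₗ RightMod.tensFun X).F M.X (regMod A)).hom :=
      ⟨⟨(δₗ (Z ⊙ₗ RightMod.tensFun X).F M.X (regMod A)).hom,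
        congrArg RightMod.Hom.hom (μₗ_comp_δₗ (F := (Z ⊙ₗ RightMod.tensFun X).F) M.X (regMod A)),
        congrArg RightMod.Hom.hom (δₗ_comp_μₗ (F := (Z ⊙ₗ RightMod.tensFun X).F) M.X (regMod A))⟩⟩
    exact (cancel_epi _).1 a
  have a := hom_nat φ (actHom M)
  have b := hom_nat ψ (actHom M)
  rw [h1, ← b] at a
  have := epi_act Z.1 M X
  have e : ((Z ⊙ₗ RightMod.tensFun X).F.map (actHom M)).hom =
    Z.1 ◁ (RightMod.tensMap (actHom M) X).hom := rfl
  rw [e] at a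
  exact (cancel_epi (Z.1 ◁ (RightMod.tensMap (actHom M) X).hom)).1 a

theorem exists_internalHom [IsAlgClosed k] [FusionCategory k C] [BraidedCategory C]
    [ModularBraiding k C] (X : Bimod A B) (G : ModFun C (RightMod A) (RightMod B)) :
    Nonempty (InternalHom (Center C) (RightMod.tensFun X) G) := by
  obtain ⟨D, u, ⟨ev, hev⟩, hD⟩ := exists_rep (k := k)
    (X := ((RightMod.tensFun X).F.obj (regMod A)).X) (Y := (G.F.obj (regMod A)).X)
    (fun Z => homSub k (Z ⊙ₗ RightMod.tensFun X) G (regMod A))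
    (by
      rintro Z W f _ ⟨φ, rfl⟩
      exact ⟨f ⊵ₗ RightMod.tensFun X ≫ φ, rfl⟩)
  have key : ∀ (Z : Center C) (φ : Z ⊙ₗ RightMod.tensFun X ⟶ G), ∃ f : Z ⟶ D,
      f ⊵ₗ RightMod.tensFun X ≫ ev = φ := by
    intro Z φ
    obtain ⟨f, hf⟩ := (hD Z).2 _ ⟨φ, rfl⟩
    refine ⟨f, hom_ext_reg X Z G _ _ ?_⟩
    rw [← hf, ← hev]
    rfl
  choose cur hcur using key
  refine ⟨⟨D, ev, fun f => cur _ f, fun f => hcur _ f, ?_⟩⟩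
  intro Z φ f hf
  have h := (hD Z).1 (f - cur Z φ) (by
    have h1 : f.f ▷ _ ≫ u = (cur Z φ).f ▷ _ ≫ u := by
      rw [← hev]
      exact congrArg (fun ψ : Z ⊙ₗ RightMod.tensFun X ⟶ G => (ψ.τ.app (regMod A)).hom)
        (hf.trans (hcur Z φ).symm)
    have h2 : (f - cur Z φ).f = f.f - (cur Z φ).f := by
      rw [sub_eq_add_neg, add_f, neg_f, sub_eq_add_neg]
    rw [h2, sub_eq_add_neg, MonoidalPreadditive.add_whiskerRight, Preadditive.add_comp, h1]
    have h3 : (-(cur Z φ).f) ▷ ((RightMod.tensFun X).F.obj (regMod A)).X =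
      -((cur Z φ).f ▷ ((RightMod.tensFun X).F.obj (regMod A)).X) := (tensorRight _).map_neg
    rw [h3, Preadditive.neg_comp, add_neg_cancel])
  exact sub_eq_zero.1 h
end
end ModHom

/-- A pivotal structure: a monoidal natural isomorphism from the identity to the double right
dual. The third field compares `π (X ⊗ Y)` with `π X ⊗ π Y` along the canonical isomorphism
`(X ⊗ Y)ᘁᘁ ≅ (Xᘁ)ᘁ ⊗ (Yᘁ)ᘁ`. -/
class PivotalCategory (C : Type u) [Category.{v} C] [MonoidalCategory C] [RigidCategory C] where
  π (X : C) : X ≅ (Xᘁ)ᘁ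
  natural {X Y : C} (f : X ⟶ Y) : f ≫ (π Y).hom = (π X).hom ≫ (fᘁ)ᘁ
  monoidal (X Y : C) : (π (X ⊗ Y)).hom ≫ ((rightDualTensorIso X Y).inv)ᘁ ≫
    (rightDualTensorIso Yᘁ Xᘁ).hom = (π X).hom ⊗ₘ (π Y).hom

namespace PivotalCategory
section
variable {C : Type u} [Category.{v} C] [MonoidalCategory C] [RigidCategory C] [PivotalCategory C]

/-- The right trace of an endomorphism. -/
def trR {X : C} (f : X ⟶ X) : 𝟙_ C ⟶ 𝟙_ C :=
  η_ X Xᘁ ≫ (f ≫ (π X).hom) ▷ Xᘁ ≫ ε_ Xᘁ (Xᘁ)ᘁ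

/-- The left coevaluation of `X`. -/
def coevL (X : C) : 𝟙_ C ⟶ Xᘁ ⊗ X :=
  η_ Xᘁ (Xᘁ)ᘁ ≫ Xᘁ ◁ (π X).inv

/-- The left trace of an endomorphism. -/
def trL {X : C} (f : X ⟶ X) : 𝟙_ C ⟶ 𝟙_ C :=
  coevL X ≫ Xᘁ ◁ f ≫ ε_ X Xᘁ

/-- The dimension of an object, as an endomorphism of the unit. -/
def dim (X : C) : 𝟙_ C ⟶ 𝟙_ C := trR (𝟙 X)

end
end PivotalCategory

/-- A pivotal structure is spherical if left and right traces agree. -/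
class SphericalCategory (C : Type u) [Category.{v} C] [MonoidalCategory C] [RigidCategory C]
    [PivotalCategory C] : Prop where
  trR_eq_trL {X : C} (f : X ⟶ X) : PivotalCategory.trR f = PivotalCategory.trL f

/-- A Frobenius algebra: an algebra and coalgebra with the two Frobenius relations. -/
structure FrobeniusAlgebra (C : Type u) [Category.{v} C] [MonoidalCategory C] where
  alg : Mon C
  coalg : ComonObj alg.X
  frobenius_left : alg.X ◁ coalg.comul ≫ (α_ _ _ _).inv ≫ MonObj.mul ▷ alg.X =
    MonObj.mul ≫ coalg.comul
  frobenius_right : coalg.comul ▷ alg.X ≫ (α_ _ _ _).hom ≫ alg.X ◁ MonObj.mul =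
    MonObj.mul ≫ coalg.comul

instance {C : Type u} [Category.{v} C] [MonoidalCategory C] [Preadditive C] [MonoidalPreadditive C]
    (A B : Mon C) : HasZeroMorphisms (Bimod A B) where
  zero X Y := ⟨{ hom := 0, left_act_hom := by simp, right_act_hom := by simp }⟩
  comp_zero f Z := Bimod.hom_ext _ _ (comp_zero (f := f.hom))
  zero_comp X Y Z f := Bimod.hom_ext _ _ (zero_comp (f := f.hom))

namespace FrobeniusAlgebra
section
variable {C : Type u} [Category.{v} C] [MonoidalCategory C]

/-- Simple: `A` is simple as a bimodule over itself. -/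
def IsSimple [Preadditive C] [MonoidalPreadditive C] (A : FrobeniusAlgebra C) : Prop :=
  Simple (Bimod.regular A.alg)

variable [RigidCategory C] [PivotalCategory C]

/-- Special: nonzero dimension, `μ ∘ Δ = id` and `ε ∘ η = dim`. -/
structure IsSpecial [Preadditive C] (A : FrobeniusAlgebra C) : Prop where
  dim_ne_zero : PivotalCategory.dim A.alg.X ≠ 0
  comul_mul : A.coalg.comul ≫ MonObj.mul = 𝟙 A.alg.X
  one_counit : MonObj.one ≫ A.coalg.counit = PivotalCategory.dim A.alg.X

/-- Symmetric: the two morphisms from `A` to its dual built from `ε ∘ μ` and the right,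
respectively left, coevaluation coincide. -/
def IsSymmetric (A : FrobeniusAlgebra C) : Prop :=
  (ρ_ A.alg.X).inv ≫ A.alg.X ◁ η_ A.alg.X A.alg.Xᘁ ≫ (α_ _ _ _).inv ≫
      (MonObj.mul ≫ A.coalg.counit) ▷ A.alg.Xᘁ ≫ (λ_ _).hom =
    (λ_ A.alg.X).inv ≫ PivotalCategory.coevL A.alg.X ▷ A.alg.X ≫ (α_ _ _ _).hom ≫
      A.alg.Xᘁ ◁ (MonObj.mul ≫ A.coalg.counit) ≫ (ρ_ _).hom
end
end FrobeniusAlgebra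

namespace InternalNat
section
variable (k : Type w) [Field k] [IsAlgClosed k] {C : Type u} [Category.{v} C] [MonoidalCategory C]
    [Abelian C] [Linear k C] [MonoidalPreadditive C] [MonoidalLinear k C] [RigidCategory C]
    [FusionCategory k C] [BraidedCategory C] [ModularBraiding k C] {A B D : Mon C}

/-- The internal natural transformations from `- ⊗_A X` to `- ⊗_A Y`, an object of the Drinfeld
center together with its universal property. -/
def iNat (X Y : Bimod A B) :
    InternalHom (Center C) (RightMod.tensFun X) (RightMod.tensFun Y) :=
  Classical.choice (ModHom.exists_internalHom (k := k) X (RightMod.tensFun Y))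

/-- The object of internal natural transformations. -/
abbrev DD (X Y : Bimod A B) : Center C := (iNat k X Y).obj

/-- Vertical composition: the canonical composition of internal Homs. -/
def muVer (X Y Z : Bimod A B) : DD k Y Z ⊗ DD k X Y ⟶ DD k X Z :=
  InternalHom.mul (iNat k Y Z) (iNat k X Y) (iNat k X Z)

/-- Left horizontal composition, determined by the universal property from the left horizontal
composite of the two universal transformations, the composite functors being identified with
`- ⊗ (X₁ ⊗ X₂)` and `- ⊗ (X₃ ⊗ X₄)`. -/
def muHorL (X₁ : Bimod A B) (X₂ : Bimod B D) (X₃ : Bimod A B) (X₄ : Bimod B D) :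
    DD k X₂ X₄ ⊗ DD k X₁ X₃ ⟶ DD k (X₁.tensorBimod X₂) (X₃.tensorBimod X₄) :=
  (iNat k (X₁.tensorBimod X₂) (X₃.tensorBimod X₄)).curry
    ((DD k X₂ X₄ ⊗ DD k X₁ X₃) ⊴ₗ (RightMod.assocIso X₁ X₂).inv ≫
      ModFun.hcompL _ _ _ _ _ _ (iNat k X₂ X₄).ev (iNat k X₁ X₃).ev ≫
        (RightMod.assocIso X₃ X₄).hom)
end
end InternalNat

end

/-! The objects of internal natural transformations enter only through their universal property. A
morphism into an internal Hom is determined by the transformation it induces after composing with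
`ev`, so the relation reduces to an equation between two module transformations out of one functor.
Once the canonical isomorphisms `assocIso` have been stripped off at both ends, this is an
interchange law for module functors in general.

Take f' : Y ⊙ G₂ ⟶ G₄ and f : Z ⊙ G₄ ⟶ G₆, and likewise g' : V ⊙ G₁ ⟶ G₃ and g : W ⊙ G₃ ⟶ G₅. In the
horizontal composite of the vertical composites, the constraint of G₂ pulls W ⊗ V inside G₂, then g'
and g are applied there, and f' and f come last. In the vertical composite of the horizontal
composites, only V is pulled inside G₂; after g' comes f', and W is then pulled inside G₄ before g
and f are applied. The two differ in the order of f' and g. Naturality of f' handles the passage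
past G₂(g). What remains is the passage of f' past the constraint of W. That f' is a module
transformation out of Y ⊙ G₂ says exactly that it turns the constraint of G₂ at W into that of G₄,
at the price of the half-braiding of Y at W. This is the only source of a braiding in the relation.

`interchange_app` carries out this argument inside the base category, at one object, and
`hcompL_interchange` transfers it to the Drinfeld center. `tensorHom_hcompL` and
`InternalHom.tensorHom_mul_ev` let composites be evaluated through the universal property, and
`eckmannHilton` assembles the pieces. -/

namespace ModFun
variable {C : Type u} [Category.{v} C] [MonoidalCategory C]
    {M : Type u₁} [Category.{v₁} M] [MonoidalLeftAction C M]
    {N : Type u₂} [Category.{v₂} N] [MonoidalLeftAction C N]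
    {P : Type u₃} [Category.{v₃} P] [MonoidalLeftAction C P]

/-! ### The interchange law in the base category, one object at a time. -/

/-- Compatibility with the module constraints, with the half-braiding moved to the other side. -/
theorem half_comm {X c : C} (e : X ⊗ c ≅ c ⊗ X) (G H : ModFun C M N) (m : M)
    (t : X ⊙ₗ G.F.obj m ⟶ H.F.obj m) (s : X ⊙ₗ G.F.obj (c ⊙ₗ m) ⟶ H.F.obj (c ⊙ₗ m))
    (h : ((αₗ c X (G.F.obj m)).inv ≫ e.inv ⊵ₗ G.F.obj m ≫ (αₗ X c (G.F.obj m)).hom ≫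
      X ⊴ₗ μₗ G.F c m) ≫ s = c ⊴ₗ t ≫ μₗ H.F c m) :
    e.hom ⊵ₗ G.F.obj m ≫ (αₗ c X (G.F.obj m)).hom ≫ c ⊴ₗ t ≫ μₗ H.F c m =
      (αₗ X c (G.F.obj m)).hom ≫ X ⊴ₗ μₗ G.F c m ≫ s := by
  rw [← h]
  simp

/-- The interchange law at one object, for a transformation `f'` compatible with `b`. -/
theorem interchange_app {z y w v : C} (b : y ⊗ w ⟶ w ⊗ y) (G H : ModFun C N P) {n₁ n₃ n₅ : N}
    {p : P} (g' : v ⊙ₗ n₁ ⟶ n₃) (g : w ⊙ₗ n₃ ⟶ n₅) (f' : ∀ n, y ⊙ₗ G.F.obj n ⟶ H.F.obj n)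
    (nat : ∀ {n n' : N} (h : n ⟶ n'), y ⊴ₗ G.F.map h ≫ f' n' = f' n ≫ H.F.map h)
    (comm : ∀ n, b ⊵ₗ G.F.obj n ≫ (αₗ w y (G.F.obj n)).hom ≫ w ⊴ₗ f' n ≫ μₗ H.F w n =
      (αₗ y w (G.F.obj n)).hom ≫ y ⊴ₗ μₗ G.F w n ≫ f' (w ⊙ₗ n))
    (f : z ⊙ₗ H.F.obj n₅ ⟶ p) :
    (αₗ (z ⊗ y) (w ⊗ v) (G.F.obj n₁)).hom ≫ (z ⊗ y) ⊴ₗ μₗ G.F (w ⊗ v) n₁ ≫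
        (z ⊗ y) ⊴ₗ G.F.map ((αₗ w v n₁).hom ≫ w ⊴ₗ g' ≫ g) ≫ (αₗ z y (G.F.obj n₅)).hom ≫
          z ⊴ₗ f' n₅ ≫ f =
      ((α_ z y (w ⊗ v)).hom ≫ z ◁ (α_ y w v).inv ≫ z ◁ b ▷ v ≫ z ◁ (α_ w y v).hom ≫
        (α_ z w (y ⊗ v)).inv) ⊵ₗ G.F.obj n₁ ≫ (αₗ (z ⊗ w) (y ⊗ v) (G.F.obj n₁)).hom ≫
        (z ⊗ w) ⊴ₗ ((αₗ y v (G.F.obj n₁)).hom ≫ y ⊴ₗ μₗ G.F v n₁ ≫ y ⊴ₗ G.F.map g' ≫ f' n₃) ≫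
          (αₗ z w (H.F.obj n₃)).hom ≫ z ⊴ₗ μₗ H.F w n₃ ≫ z ⊴ₗ H.F.map g ≫ f := by
  -- The objects `w` and `y` change places before `z` and `f` act, so both are dropped here and
  -- restored at the end by whiskering.
  have key : (αₗ y (w ⊗ v) (G.F.obj n₁)).hom ≫ y ⊴ₗ μₗ G.F (w ⊗ v) n₁ ≫
      y ⊴ₗ G.F.map ((αₗ w v n₁).hom ≫ w ⊴ₗ g' ≫ g) ≫ f' n₅ =
      ((α_ y w v).inv ≫ b ▷ v ≫ (α_ w y v).hom) ⊵ₗ G.F.obj n₁ ≫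
        (αₗ w (y ⊗ v) (G.F.obj n₁)).hom ≫
        w ⊴ₗ ((αₗ y v (G.F.obj n₁)).hom ≫ y ⊴ₗ μₗ G.F v n₁ ≫ y ⊴ₗ G.F.map g' ≫ f' n₃) ≫
          μₗ H.F w n₃ ≫ H.F.map g := by
    -- The part without braiding: splitting the constraint of `G` at `w ⊗ v` into those at `v` and
    -- `w`, and using naturality of `f'` to apply `g` after `f'`, isolates the composite that `comm`
    -- can rewrite.
    have h1 : (αₗ y (w ⊗ v) (G.F.obj n₁)).hom ≫ y ⊴ₗ μₗ G.F (w ⊗ v) n₁ ≫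
        y ⊴ₗ G.F.map ((αₗ w v n₁).hom ≫ w ⊴ₗ g' ≫ g) ≫ f' n₅ =
        (α_ y w v).inv ⊵ₗ G.F.obj n₁ ≫ (αₗ (y ⊗ w) v (G.F.obj n₁)).hom ≫
          (y ⊗ w) ⊴ₗ (μₗ G.F v n₁ ≫ G.F.map g') ≫ ((αₗ y w (G.F.obj n₃)).hom ≫
            y ⊴ₗ μₗ G.F w n₃ ≫ f' (w ⊙ₗ n₃)) ≫ H.F.map g := by
      simp only [← nat, Functor.map_comp, actionHomRight_comp, Category.assoc]
      rw [← actionHomRight_comp_assoc y (μₗ G.F (w ⊗ v) n₁), μₗ_associativity]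
      -- The constraint at `w` is natural, so `g'` may be applied before or after `w` has been
      -- pulled inside `G`.
      have h3 : y ⊴ₗ w ⊴ₗ G.F.map g' ≫ y ⊴ₗ μₗ G.F w n₃ =
          y ⊴ₗ μₗ G.F w (v ⊙ₗ n₁) ≫ y ⊴ₗ G.F.map (w ⊴ₗ g') := by
        rw [← actionHomRight_comp, μₗ_naturality_right, actionHomRight_comp]
      -- Cancels the inverse associator on the right; what is left on the other side is the pentagon
      -- for the action, within reach of `simp`.
      rw [← cancel_epi ((α_ y w v).hom ⊵ₗ G.F.obj n₁)]
      simp [reassoc_of% h3]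
    -- The one place where `b` appears: `f'` at `w ⊙ n₃`, preceded by the constraint of `G`, is
    -- traded for `f'` at `n₃` followed by the constraint of `H`.
    rw [h1, ← comm]
    simp only [Category.assoc]
    -- `b` acts on `y ⊗ w` and `g'` on the module factor, so `b` slides to the front.
    rw [action_exchange_assoc]
    simp
  -- The two pentagons that absorb the associators moving `z` past the reordered factors.
  have e₁ := act_coh₂ z w (y ⊗ v) (G.F.obj n₁)
  have e₂ := act_coh₁ z y (w ⊗ v) (G.F.obj n₁)
  rw [Iso.inv_comp_eq] at e₂
  simp only [comp_actionHomLeft, whiskerLeft_actionHomLeft, Category.assoc,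
    Iso.inv_hom_id_assoc, reassoc_of% e₁, reassoc_of% e₂, tensor_actionHomRight]
  -- With the leading associator on the right, the left side of `key`, whiskered by `z`, occurs
  -- verbatim in the goal.
  rw [← Iso.eq_inv_comp] at key
  have h := congrArg (z ⊴ₗ ·) key
  simp only [actionHomRight_comp, comp_actionHomLeft, Category.assoc] at h ⊢
  simp only [reassoc_of% h]

/-! ### Horizontal composition of module transformations over the Drinfeld center. -/

/-- Unfolding leaves one spurious factor: `compAct` has identity components and disappears. The
half-braidings of `Z` and `W` leave no trace in the components; they matter only for compatibility
with the module constraints. -/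
theorem hcompL_app (G₁ G₃ : ModFun C M N) (G₂ G₄ : ModFun C N P) (Z W : Center C)
    (f : Z ⊙ₗ G₂ ⟶ G₄) (g : W ⊙ₗ G₁ ⟶ G₃) (m : M) :
    (hcompL G₁ G₃ G₂ G₄ Z W f g).τ.app m =
      (αₗ (Sigma.fst Z) (Sigma.fst W) (G₂.F.obj (G₁.F.obj m))).hom ≫
        Sigma.fst Z ⊴ₗ μₗ G₂.F (Sigma.fst W) (G₁.F.obj m) ≫
          Sigma.fst Z ⊴ₗ G₂.F.map (g.τ.app m) ≫ f.τ.app (G₃.F.obj m) := by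
  have h : (hcompL G₁ G₃ G₂ G₄ Z W f g).τ.app m =
      (αₗ (Sigma.fst Z) (Sigma.fst W) (G₂.F.obj (G₁.F.obj m))).hom ≫
        Sigma.fst Z ⊴ₗ μₗ G₂.F (Sigma.fst W) (G₁.F.obj m) ≫
          Sigma.fst Z ⊴ₗ G₂.F.map (g.τ.app m) ≫ 𝟙 _ ≫ f.τ.app (G₃.F.obj m) := rfl
  rw [h]
  congr 3
  exact Category.id_comp _

/-- Left horizontal composition is natural in the objects of the Drinfeld center. -/
theorem tensorHom_hcompL (G₁ G₃ : ModFun C M N) (G₂ G₄ : ModFun C N P) {Z Z' W W' : Center C}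
    (a : Z ⟶ Z') (b : W ⟶ W') (f : Z' ⊙ₗ G₂ ⟶ G₄) (g : W' ⊙ₗ G₁ ⟶ G₃) :
    (a ⊗ₘ b) ⊵ₗ comp G₁ G₂ ≫ hcompL G₁ G₃ G₂ G₄ Z' W' f g =
      hcompL G₁ G₃ G₂ G₄ Z W (a ⊵ₗ G₂ ≫ f) (b ⊵ₗ G₁ ≫ g) := by
  ext m
  rw [hcompL_app]
  change (a.f ⊗ₘ b.f) ⊵ₗ G₂.F.obj (G₁.F.obj m) ≫ (hcompL G₁ G₃ G₂ G₄ Z' W' f g).τ.app m = _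
  rw [hcompL_app]
  -- Compatibility with half-braidings plays no role at the level of components, so the identity is
  -- proved for arbitrary morphisms of the base category. It combines naturality of the constraint
  -- of `G₂` in the acting object with the exchange of the two sides of the action.
  have key : ∀ {z z' w w' : C} (a : z ⟶ z') (b : w ⟶ w') {n n' : N} {p : P}
      (f : z' ⊙ₗ G₂.F.obj n' ⟶ p) (g : w' ⊙ₗ n ⟶ n'),
      (a ⊗ₘ b) ⊵ₗ G₂.F.obj n ≫ (αₗ z' w' (G₂.F.obj n)).hom ≫ z' ⊴ₗ μₗ G₂.F w' n ≫
        z' ⊴ₗ G₂.F.map g ≫ f =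
      (αₗ z w (G₂.F.obj n)).hom ≫ z ⊴ₗ μₗ G₂.F w n ≫ z ⊴ₗ G₂.F.map (b ⊵ₗ n ≫ g) ≫
        a ⊵ₗ G₂.F.obj n' ≫ f := by
    intro z z' w w' a b n n' p f g
    have h := congrArg (z' ⊴ₗ ·) (μₗ_naturality_left G₂.F b n)
    simp only [actionHomRight_comp] at h
    rw [← actionHomRight_comp_assoc, ← actionHomRight_comp_assoc, action_exchange_assoc]
    simp [MonoidalCategory.tensorHom_def, reassoc_of% h]
  exact key a.f b.f (f.τ.app _) (g.τ.app m)

/-- The interchange law for left horizontal and vertical composition. -/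
theorem hcompL_interchange (G₁ G₃ G₅ : ModFun C M N) (G₂ G₄ G₆ : ModFun C N P)
    (Z Y W V : Center C) (f : Z ⊙ₗ G₄ ⟶ G₆) (f' : Y ⊙ₗ G₂ ⟶ G₄) (g : W ⊙ₗ G₃ ⟶ G₅)
    (g' : V ⊙ₗ G₁ ⟶ G₃) :
    hcompL G₁ G₅ G₂ G₆ (Z ⊗ Y) (W ⊗ V) ((αₗ Z Y G₂).hom ≫ Z ⊴ₗ f' ≫ f)
        ((αₗ W V G₁).hom ≫ W ⊴ₗ g' ≫ g) =
      tensorμ Z Y W V ⊵ₗ comp G₁ G₂ ≫ (αₗ (Z ⊗ W) (Y ⊗ V) (comp G₁ G₂)).hom ≫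
        (Z ⊗ W) ⊴ₗ hcompL G₁ G₃ G₂ G₄ Y V f' g' ≫ hcompL G₃ G₅ G₄ G₆ Z W f g := by
  ext m
  rw [hcompL_app]
  -- The braiding of the center at `Y` and `W` is by definition the half-braiding of `Y` at the
  -- underlying object of `W`. The inverse associators of the center are identified by a lemma, and
  -- the rest by unfolding.
  have h : (tensorμ Z Y W V).f = (α_ Z.1 Y.1 (W.1 ⊗ V.1)).hom ≫ Z.1 ◁ (α_ Y.1 W.1 V.1).inv ≫
      Z.1 ◁ (Y.2.β W.1).hom ▷ V.1 ≫ Z.1 ◁ (α_ W.1 Y.1 V.1).hom ≫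
        (α_ Z.1 W.1 (Y.1 ⊗ V.1)).inv := by
    change (α_ Z.1 Y.1 (W.1 ⊗ V.1)).hom ≫ Z.1 ◁ Center.Hom.f (α_ Y W V).inv ≫
      Z.1 ◁ (Y.2.β W.1).hom ▷ V.1 ≫ Z.1 ◁ (α_ W.1 Y.1 V.1).hom ≫
        Center.Hom.f (α_ Z W (Y ⊗ V)).inv = _
    rw [Center.associator_inv_f, Center.associator_inv_f]
    rfl
  change _ = (tensorμ Z Y W V).f ⊵ₗ G₂.F.obj (G₁.F.obj m) ≫
    (αₗ (Z.1 ⊗ W.1) (Y.1 ⊗ V.1) (G₂.F.obj (G₁.F.obj m))).hom ≫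
      (Z.1 ⊗ W.1) ⊴ₗ (hcompL G₁ G₃ G₂ G₄ Y V f' g').τ.app m ≫
        (hcompL G₃ G₅ G₄ G₆ Z W f g).τ.app m
  rw [hcompL_app, hcompL_app, h]
  exact interchange_app (Y.2.β W.1).hom G₂ G₄ (g'.τ.app m) (g.τ.app m) (fun n => f'.τ.app n)
    (fun h => f'.τ.naturality h)
    -- The module compatibility of `f'` at the object `W` is stated with the inverse half-braiding;
    -- `half_comm` puts it in the form that `interchange_app` expects.
    (fun n => half_comm (Y.2.β W.1) G₂ G₄ n (f'.τ.app n) (f'.τ.app _) (f'.comm W.1 n))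
    (f.τ.app _)
end ModFun

/-! ### Testing morphisms into internal Homs against evaluation. -/

namespace InternalHom
variable {V : Type u} [Category.{v} V] [MonoidalCategory V]
    {M : Type u₁} [Category.{v₁} M] [MonoidalLeftAction V M]

theorem hom_ext {m n : M} (a : InternalHom V m n) {v : V} {f g : v ⟶ a.obj}
    (h : f ⊵ₗ m ≫ a.ev = g ⊵ₗ m ≫ a.ev) : f = g :=
  (a.uniq _ f h).trans (a.uniq _ g rfl).symm

theorem mul_ev {l m n : M} (a : InternalHom V m n) (b : InternalHom V l m)
    (c : InternalHom V l n) :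
    mul a b c ⊵ₗ l ≫ c.ev = (αₗ _ _ _).hom ≫ a.obj ⊴ₗ b.ev ≫ a.ev :=
  c.curry_ev _

/-- Reduces a composite of two morphisms given by their universal property to the transformations
they represent. It holds because `f` acts on the left and `b.ev` on the right, so the two can be
exchanged. -/
theorem tensorHom_mul_ev {l m n : M} (a : InternalHom V m n) (b : InternalHom V l m)
    (c : InternalHom V l n) {x y : V} (f : x ⟶ a.obj) (g : y ⟶ b.obj) :
    ((f ⊗ₘ g) ≫ mul a b c) ⊵ₗ l ≫ c.ev =
      (αₗ x y l).hom ≫ x ⊴ₗ (g ⊵ₗ l ≫ b.ev) ≫ f ⊵ₗ m ≫ a.ev := by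
  rw [comp_actionHomLeft, Category.assoc, mul_ev, action_exchange_assoc]
  simp [MonoidalCategory.tensorHom_def]
end InternalHom

/-! ### The relation for internal natural transformations. -/

namespace InternalNat
variable (k : Type w) [Field k] [IsAlgClosed k] {C : Type u} [Category.{v} C] [MonoidalCategory C]
    [Abelian C] [Linear k C] [MonoidalPreadditive C] [MonoidalLinear k C] [RigidCategory C]
    [FusionCategory k C] [BraidedCategory C] [ModularBraiding k C] {A B D : Mon C}

theorem muHorL_ev (X₁ : Bimod A B) (X₂ : Bimod B D) (X₃ : Bimod A B) (X₄ : Bimod B D) :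
    muHorL k X₁ X₂ X₃ X₄ ⊵ₗ RightMod.tensFun (X₁.tensorBimod X₂) ≫
        (iNat k (X₁.tensorBimod X₂) (X₃.tensorBimod X₄)).ev =
      (DD k X₂ X₄ ⊗ DD k X₁ X₃) ⊴ₗ (RightMod.assocIso X₁ X₂).inv ≫
        ModFun.hcompL _ _ _ _ _ _ (iNat k X₂ X₄).ev (iNat k X₁ X₃).ev ≫
          (RightMod.assocIso X₃ X₄).hom :=
  InternalHom.curry_ev _ _

/-- The internal Eckmann–Hilton relation, for bimodules over arbitrary algebras. -/
theorem eckmannHilton (X₁ X₃ X₅ : Bimod A B) (X₂ X₄ X₆ : Bimod B D) :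
    (muVer k X₂ X₄ X₆ ⊗ₘ muVer k X₁ X₃ X₅) ≫ muHorL k X₁ X₂ X₅ X₆ =
      tensorμ (DD k X₄ X₆) (DD k X₂ X₄) (DD k X₃ X₅) (DD k X₁ X₃) ≫
        (muHorL k X₃ X₄ X₅ X₆ ⊗ₘ muHorL k X₁ X₂ X₃ X₄) ≫
          muVer k (X₁.tensorBimod X₂) (X₃.tensorBimod X₄) (X₅.tensorBimod X₆) := by
  -- On the left side, the two vertical compositions are moved past `assocIso` and then absorbed
  -- into the arguments of `hcompL`, where they become composites of evaluations.
  apply InternalHom.hom_ext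
  rw [comp_actionHomLeft, Category.assoc, muHorL_ev, ← action_exchange_assoc,
    ← Category.assoc (_ ⊵ₗ _), ModFun.tensorHom_hcompL]
  unfold muVer
  -- The left side is now the horizontal composite of two vertical ones, so the interchange law
  -- applies and produces `tensorμ`.
  rw [InternalHom.mul_ev, InternalHom.mul_ev, ModFun.hcompL_interchange,
    comp_actionHomLeft]
  simp only [Category.assoc]
  rw [InternalHom.tensorHom_mul_ev, muHorL_ev, muHorL_ev]
  simp only [actionHomRight_comp, Category.assoc]
  -- On the right side, the two horizontal compositions meet at `X₃ ⊗ X₄`, where `assocIso` cancels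
  -- its inverse. On the left side, the outer `assocIso` is exchanged with `tensorμ` to match.
  rw [actionHomRight_hom_inv_assoc, action_exchange_assoc]
  simp only [tensor_actionHomRight, Category.assoc, Iso.inv_hom_id_assoc]
end InternalNat

/-- With associators made explicit, `tensorμ` is the identity on the outer two factors and, on the
middle two, the braiding of the center, that is, the half-braiding of the second factor at the
third. -/
theorem mainTheorem4 (k : Type w) [Field k] [IsAlgClosed k] [CharZero k]
    (C : Type u) [Category.{v} C] [MonoidalCategory C] [Abelian C] [Linear k C]
    [MonoidalPreadditive C] [MonoidalLinear k C] [RigidCategory C] [FusionCategory k C]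
    [PivotalCategory C] [SphericalCategory C] [BraidedCategory C] [ModularBraiding k C]
    (A A' A'' : FrobeniusAlgebra C)
    (hA : A.IsSimple ∧ A.IsSpecial ∧ A.IsSymmetric)
    (hA' : A'.IsSimple ∧ A'.IsSpecial ∧ A'.IsSymmetric)
    (hA'' : A''.IsSimple ∧ A''.IsSpecial ∧ A''.IsSymmetric)
    (X₁ X₃ X₅ : Bimod A.alg A'.alg) (X₂ X₄ X₆ : Bimod A'.alg A''.alg) :
    (InternalNat.muVer k X₂ X₄ X₆ ⊗ₘ InternalNat.muVer k X₁ X₃ X₅) ≫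
        InternalNat.muHorL k X₁ X₂ X₅ X₆ =
      tensorμ (InternalNat.DD k X₄ X₆) (InternalNat.DD k X₂ X₄)
          (InternalNat.DD k X₃ X₅) (InternalNat.DD k X₁ X₃) ≫
        (InternalNat.muHorL k X₃ X₄ X₅ X₆ ⊗ₘ InternalNat.muHorL k X₁ X₂ X₃ X₄) ≫
          InternalNat.muVer k (X₁.tensorBimod X₂) (X₃.tensorBimod X₄)
            (X₅.tensorBimod X₆) :=
  InternalNat.eckmannHilton k X₁ X₃ X₅ X₂ X₄ X₆
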